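/- **Setting.** Let $\mathbb F_q$ be a finite field of characteristic different from $2$ and $3$, let $A,B\in\mathbb F_q$ be such that $f(x)=x^3+Ax+B$ has no multiple roots, and let $E$ be the elliptic curve $y^2=f(x)$, with neutral element $P_\infty$. Let $\varphi:(x,y)\mapsto(x^q,y^q)$ be the Frobenius endomorphism of $E(\mathbb F_{q^3})$ and $T_3=\{P\in E(\mathbb F_{q^3}) : P+\varphi(P)+\varphi^2(P)=P_\infty\}$. For $P\in T_3\setminus\{P_\infty\}$ let $h_P=y-(\alpha_1x+\alpha_0)$, $\alpha_1,\alpha_0\in\mathbb F_q$, be the line through $P,\varphi(P),\varphi^2(P)$ counted with multiplicity, i.e. $\mathrm{div}(h_P)=P+\varphi(P)+\varphi^2(P)-3P_\infty$; then $h_{-P}=y+(\alpha_1x+\alpha_0)$. If $P=P_\infty$, then $h_P$ denotes a nonzero constant. For $P,Q\in T_3\setminus\{P_\infty\}$, $S_{P,Q}=(S_{P,Q})_1(x)+y\,(S_{P,Q})_2(x)\in\mathbb F_q[x,y]$ is the polynomial, determined up to a nonzero constant, with $\mathrm{div}(S_{P,Q})=\sum_{0\le i,j\le 2}(\varphi^i(P)+\varphi^j(Q))-9P_\infty$.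 **Procedure 1.** Input: the coefficients of $h_P=y-(\alpha_1x+\alpha_0)$ and $h_Q=y-(\beta_1x+\beta_0)$, as elements of $\mathbb F_q$ or as indeterminates over $\mathbb F_q$. In the polynomial ring in the variables $x_{P_i},y_{P_i},x_{Q_i},y_{Q_i}$ $(1\le i\le 3)$, $x$, $y$ put $$t_i=f'(x_{P_i})x-2y_{P_i}y+(2y_{P_i}^2-f'(x_{P_i})x_{P_i}),$$ $$r_{ij}=(y_{Q_j}-y_{P_i})x+(x_{P_i}-x_{Q_j})y+\big((x_{Q_j}-x_{P_i})y_{P_i}+(y_{P_i}-y_{Q_j})x_{P_i}\big),$$ $T=\prod_{i=1}^3t_i$ and $R=\prod_{1\le i,j\le 3}r_{ij}$. In $T$ and $R$ replace $y_{P_i}$ by $\alpha_1x_{P_i}+\alpha_0$ and $y_{Q_i}$ by $\beta_1x_{Q_i}+\beta_0$; write the results as polynomials in $x$, $y$, the elementary symmetric polynomials $e_1,e_2,e_3$ of $x_{P_1},x_{P_2},x_{P_3}$ and the elementary symmetric polynomials $s_1,s_2,s_3$ of $x_{Q_1},x_{Q_2},x_{Q_3}$; then replace $e_1,e_2,e_3$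 by $\alpha_1^2,\ A-2\alpha_0\alpha_1,\ \alpha_0^2-B$ and $s_1,s_2,s_3$ by $\beta_1^2,\ A-2\beta_0\beta_1,\ \beta_0^2-B$. This gives polynomials $T(x,y)$ and $R(x,y)$. Finally recover $h_{2P}$ and $S_{P,Q}$, up to nonzero constants, from $$h_{2P}=T(x,-y)/h_{-P}^2 \bmod y^2-f(x),\qquad (S_{P,Q})_1(x)-y\,(S_{P,Q})_2(x)=R(x,y)/(h_P^3h_Q^3)\bmod y^2-f(x).$$ **Theorem (Procedure 1 is correct).** (a) *The procedure yields the formulas below.* The rewriting in elementary symmetric polynomials is possible and gives unique $T(x,y)$, $R(x,y)$. When $\alpha_1,\alpha_0,\beta_1,\beta_0$ are indeterminates over $\mathbb F_q$, there are nonzero $\kappa,\kappa'\in\mathbb F_q[\alpha_1,\alpha_0,\beta_1,\beta_0]$ such that, modulo $y^2-f(x)$, $$T(x,-y)=\kappa\,\big(y+(\alpha_1x+\alpha_0)\big)^2\big(cy-(u_0+u_1x)\big),$$ $$R(x,y)=\kappa'\,\big(y-(\alpha_1x+\alpha_0)\big)^3\big(y-(\beta_1x+\beta_0)\big)^3\Big(\sum_{i=0}^4a_ix^i-y\sum_{i=0}^3b_ix^i\Big),$$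 with $a_i,b_i,c,u_i$ given by formulas (1) and (2) below. (b) *The equalities of the procedure are correct.* Let $P,Q\in T_3\setminus\{P_\infty\}$, and run the procedure on the coefficients in $\mathbb F_q$ of $h_P$ and $h_Q$. The rewriting again gives unique $T(x,y)$, $R(x,y)$. A polynomial $g\in\mathbb F_q[x,y]$ satisfies $T(x,-y)=k\,h_{-P}^2\,g \bmod y^2-f(x)$ for some $k\in\mathbb F_q^*$ if and only if $\mathrm{div}(g)=\mathrm{div}(h_{2P})$, that is, $\mathrm{div}(g)=\sum_{i=0}^2\varphi^i(2P)-3P_\infty$. If moreover $h_P\ne h_Q$, then $g$ satisfies $R(x,y)=k\,h_P^3h_Q^3\,g(x,-y)\bmod y^2-f(x)$ for some $k\in\mathbb F_q^*$ if and only if $\mathrm{div}(g)=\mathrm{div}(S_{P,Q})$. (c) *The formulas are correct in all cases*, including $h_P=y$ and $h_Q=h_{\pm P}$. For all $P,Q\in T_3\setminus\{P_\infty\}$ with $h_P=y-(\alpha_1x+\alpha_0)$ and $h_Q=y-(\beta_1x+\beta_0)$: polynomials $s_1,s_2\in\mathbb F_q[x]$ satisfy $\mathrm{div}(s_1+ys_2)=\mathrm{div}(S_{P,Q})$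 if and only if, for some $k\in\mathbb F_q^*$, $s_1=k(a_4x^4+a_3x^3+a_2x^2+a_1x+a_0)$ and $s_2=k(b_3x^3+b_2x^2+b_1x+b_0)$, with the $a_i,b_i$ of (1). Elements $d,v_0,v_1\in\mathbb F_q$ satisfy $\mathrm{div}(dy-(v_0+v_1x))=\sum_{i=0}^2\varphi^i(2P)-3P_\infty$ if and only if $(d,v_0,v_1)=k(c,u_0,u_1)$ for some $k\in\mathbb F_q^*$, with the $c,u_0,u_1$ of (2). In particular, if $2P\ne P_\infty$, then $c\neq 0$ and $h_{2P}=y-\left(\frac{u_1}{c}x+\frac{u_0}{c}\right)$. **Formulas (1)** for the coefficients of $S_{P,Q}$: $a_4 = -\alpha_1^3\beta_1\beta_0^2 - 3B\alpha_1^3\beta_1 + 2A\alpha_1^3\beta_0 + 2\alpha_1^2\alpha_0\beta_1^2\beta_0 + A\alpha_1^2\alpha_0\beta_1 - 6B\alpha_1^2\beta_1^2 + 3A\alpha_1^2\beta_1\beta_0 + A^2\alpha_1^2 - \alpha_1\alpha_0^2\beta_1^3 + 6\alpha_1\alpha_0^2\beta_0 + 3A\alpha_1\alpha_0\beta_1^2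 + 3\alpha_1\alpha_0\beta_0^2 + 9B\alpha_1\alpha_0 - 3B\alpha_1\beta_1^3 + A\alpha_1\beta_1^2\beta_0 + 2A^2\alpha_1\beta_1 - 3\alpha_1\beta_0^3 + 9B\alpha_1\beta_0 - 3\alpha_0^3\beta_1 + 3\alpha_0^2\beta_1\beta_0 - 3A\alpha_0^2 + 2A\alpha_0\beta_1^3 + 6\alpha_0\beta_1\beta_0^2 + 9B\alpha_0\beta_1 - 6A\alpha_0\beta_0 + A^2\beta_1^2 + 9B\beta_1\beta_0 - 3A\beta_0^2$ $a_3 = 4B\alpha_1^3\beta_1^3 - 2A\alpha_1^3\beta_1^2\beta_0 + A^2\alpha_1^3\beta_1 - \alpha_1^3\beta_0^3 + 9B\alpha_1^3\beta_0 - 2A\alpha_1^2\alpha_0\beta_1^3 - \alpha_1^2\alpha_0\beta_1\beta_0^2 + 3B\alpha_1^2\alpha_0\beta_1 - 7A\alpha_1^2\alpha_0\beta_0 + A^2\alpha_1^2\beta_1^2 - 6B\alpha_1^2\beta_1\beta_0 + 3A\alpha_1^2\beta_0^2 + 6AB\alpha_1^2 - \alpha_1\alpha_0^2\beta_1^2\beta_0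 + A\alpha_1\alpha_0^2\beta_1 - 6B\alpha_1\alpha_0\beta_1^2 + 12A\alpha_1\alpha_0\beta_1\beta_0 - 8A^2\alpha_1\alpha_0 + A^2\alpha_1\beta_1^3 + 3B\alpha_1\beta_1^2\beta_0 + A\alpha_1\beta_1\beta_0^2 - 6AB\alpha_1\beta_1 + 4A^2\alpha_1\beta_0 - \alpha_0^3\beta_1^3 - 3\alpha_0^3\beta_0 + 3A\alpha_0^2\beta_1^2 + 21\alpha_0^2\beta_0^2 - 18B\alpha_0^2 + 9B\alpha_0\beta_1^3 - 7A\alpha_0\beta_1^2\beta_0 + 4A^2\alpha_0\beta_1 - 3\alpha_0\beta_0^3 + 18B\alpha_0\beta_0 + 6AB\beta_1^2 - 8A^2\beta_1\beta_0 - 18B\beta_0^2 + 4A^3 + 27B^2$ $a_2 = -A^2\alpha_1^3\beta_1^3 - 2A\alpha_1^3\beta_1\beta_0^2 - 6AB\alpha_1^3\beta_1 + A^2\alpha_1^3\beta_0 - 2A\alpha_1^2\alpha_0\beta_1^2\beta_0 + 5A^2\alpha_1^2\alpha_0\beta_1 - 3\alpha_1^2\alpha_0\beta_0^3 - 9B\alpha_1^2\alpha_0\beta_0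 + 6AB\alpha_1^2\beta_1^2 + 9B\alpha_1^2\beta_0^2 + (2A^3+ 27B^2)\alpha_1^2 - 2A\alpha_1\alpha_0^2\beta_1^3 - 3\alpha_1\alpha_0^2\beta_1\beta_0^2 + 9B\alpha_1\alpha_0^2\beta_1 + 9A\alpha_1\alpha_0^2\beta_0 + 36B\alpha_1\alpha_0\beta_1\beta_0 - 12A\alpha_1\alpha_0\beta_0^2 - 18AB\alpha_1\alpha_0 - 6AB\alpha_1\beta_1^3 + 5A^2\alpha_1\beta_1^2\beta_0 + 9B\alpha_1\beta_1\beta_0^2 + (4A^3 - 27B^2)\alpha_1\beta_1 - 3A\alpha_1\beta_0^3 + 36AB\alpha_1\beta_0 - 3\alpha_0^3\beta_1^2\beta_0 - 3A\alpha_0^3\beta_1 + 9B\alpha_0^2\beta_1^2 - 12A\alpha_0^2\beta_1\beta_0 + 6A^2\alpha_0^2 + A^2\alpha_0\beta_1^3 - 9B\alpha_0\beta_1^2\beta_0 + 9A\alpha_0\beta_1\beta_0^2 + 36AB\alpha_0\beta_1 - 24A^2\alpha_0\beta_0 + (2A^3 + 27B^2)\beta_1^2 - 18AB\beta_1\beta_0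 + 6A^2\beta_0^2$ $a_1 = -A^2\alpha_1^3\beta_1^2\beta_0 - 4B\alpha_1^3\beta_1\beta_0^2 + (A^3 - 12B^2)\alpha_1^3\beta_1 + 8AB\alpha_1^3\beta_0 - A^2\alpha_1^2\alpha_0\beta_1^3 - 4B\alpha_1^2\alpha_0\beta_1^2\beta_0 + 16AB\alpha_1^2\alpha_0\beta_1 - 3A^2\alpha_1^2\alpha_0\beta_0 + (-3A^3 + 12B^2)\alpha_1^2\beta_1^2 - 24AB\alpha_1^2\beta_1\beta_0 + 3A^2\alpha_1^2\beta_0^2 - 2A^2B\alpha_1^2 - 4B\alpha_1\alpha_0^2\beta_1^3 - 3A^2\alpha_1\alpha_0^2\beta_1 - 3\alpha_1\alpha_0^2\beta_0^3 + 15B\alpha_1\alpha_0^2\beta_0 - 24AB\alpha_1\alpha_0\beta_1^2 + 12A^2\alpha_1\alpha_0\beta_1\beta_0 - 6B\alpha_1\alpha_0\beta_0^2 - 18B^2\alpha_1\alpha_0 + (A^3 - 12B^2)\alpha_1\beta_1^3 + 16AB\alpha_1\beta_1^2\beta_0 - 3A^2\alpha_1\beta_1\beta_0^2 + 14A^2B\alpha_1\beta_1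 - 3B\alpha_1\beta_0^3 + 63B^2\alpha_1\beta_0 - 3\alpha_0^3\beta_1\beta_0^2 - 3B\alpha_0^3\beta_1 - 3A\alpha_0^3\beta_0 + 3A^2\alpha_0^2\beta_1^2 - 6B\alpha_0^2\beta_1\beta_0 + 9A\alpha_0^2\beta_0^2 + 6AB\alpha_0^2 + 8AB\alpha_0\beta_1^3 - 3A^2\alpha_0\beta_1^2\beta_0 + 15B\alpha_0\beta_1\beta_0^2 + 63B^2\alpha_0\beta_1 - 3A\alpha_0\beta_0^3 - 42AB\alpha_0\beta_0 - 2A^2B\beta_1^2 - 18B^2\beta_1\beta_0 + 6AB\beta_0^2 + 4A^4 + 27AB^2$ $a_0 = 2A^2B\alpha_1^3\beta_1 - A^3\alpha_1^3\beta_0 - A^2\alpha_1^2\alpha_0\beta_1^2\beta_0 - 4B\alpha_1^2\alpha_0\beta_1\beta_0^2 + 12B^2\alpha_1^2\alpha_0\beta_1 -4AB\alpha_1^2\alpha_0\beta_0 - 5A^2B\alpha_1^2\beta_1^2 + (A^3 - 24B^2)\alpha_1^2\beta_1\beta_0 + 6AB\alpha_1^2\beta_0^2 + (A^4 + 6AB^2)\alpha_1^2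 - 4B\alpha_1\alpha_0^2\beta_1^2\beta_0 + 2A\alpha_1\alpha_0^2\beta_1\beta_0^2 - 2AB\alpha_1\alpha_0^2\beta_1 - A^2\alpha_1\alpha_0^2\beta_0+ (A^3 - 24B^2)\alpha_1\alpha_0\beta_1^2 + 24AB\alpha_1\alpha_0\beta_1\beta_0 - 3A^2\alpha_1\alpha_0\beta_0^2 + A^2B\alpha_1\alpha_0 + 2A^2B\alpha_1\beta_1^3 + 12B^2\alpha_1\beta_1^2\beta_0 - 2AB\alpha_1\beta_1\beta_0^2 + (-2A^4 - 6AB^2)\alpha_1\beta_1 - 5A^2B\alpha_1\beta_0 - \alpha_0^3\beta_0^3 - 3B\alpha_0^3\beta_0 + 6AB\alpha_0^2\beta_1^2 - 3A^2\alpha_0^2\beta_1\beta_0 + 3B\alpha_0^2\beta_0^2 + (A^3 + 9B^2)\alpha_0^2 - A^3\alpha_0\beta_1^3 - 4AB\alpha_0\beta_1^2\beta_0 - A^2\alpha_0\beta_1\beta_0^2 - 5A^2B\alpha_0\beta_1 - 3B\alpha_0\beta_0^3 + (2A^3 - 9B^2)\alpha_0\beta_0 + (A^4 + 6AB^2)\beta_1^2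 + A^2B\beta_1\beta_0 + (A^3 + 9B^2)\beta_0^2 + 4A^3B + 27B^3$ $b_3 = \alpha_1^3\beta_0^2 - B\alpha_1^3 - 2\alpha_1^2\alpha_0\beta_1\beta_0 + A\alpha_1^2\alpha_0 + \alpha_1^2\beta_1\beta_0^2 - 3B\alpha_1^2\beta_1 + A\alpha_1^2\beta_0 + \alpha_1\alpha_0^2\beta_1^2 - 2\alpha_1\alpha_0\beta_1^2\beta_0 + 2A\alpha_1\alpha_0\beta_1 - 3B\alpha_1\beta_1^2 + 2A\alpha_1\beta_1\beta_0 + \alpha_0^3 + \alpha_0^2\beta_1^3 + 3\alpha_0^2\beta_0 + A\alpha_0\beta_1^2 + 3\alpha_0\beta_0^2 - B\beta_1^3 + A\beta_1^2\beta_0 + \beta_0^3$ $b_2 = A^2\alpha_1^3 + 3\alpha_1^2\alpha_0\beta_0^2 + 9B\alpha_1^2\alpha_0 + 3A^2\alpha_1^2\beta_1 + 3\alpha_1^2\beta_0^3 + 9B\alpha_1^2\beta_0 - 6\alpha_1\alpha_0^2\beta_1\beta_0 - 3A\alpha_1\alpha_0^2 - 6\alpha_1\alpha_0\beta_1\beta_0^2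 + 18B\alpha_1\alpha_0\beta_1 - 6A\alpha_1\alpha_0\beta_0 + 3A^2\alpha_1\beta_1^2 + 18B\alpha_1\beta_1\beta_0 - 3A\alpha_1\beta_0^2 + 3\alpha_0^3\beta_1^2 + 3\alpha_0^2\beta_1^2\beta_0 - 3A\alpha_0^2\beta_1 + 9B\alpha_0\beta_1^2 - 6A\alpha_0\beta_1\beta_0 + A^2\beta_1^3 + 9B\beta_1^2\beta_0 - 3A\beta_1\beta_0^2$ $b_1 = -A^2\alpha_1^3\beta_1^2 - 2A\alpha_1^3\beta_0^2 + 2AB\alpha_1^3 - 12B\alpha_1^2\alpha_0\beta_1^2 + 4A\alpha_1^2\alpha_0\beta_1\beta_0 - 3A^2\alpha_1^2\alpha_0 - A^2\alpha_1^2\beta_1^3 - 12B\alpha_1^2\beta_1^2\beta_0 + 4A\alpha_1^2\beta_1\beta_0^2 + A^2\alpha_1^2\beta_0 + 4A\alpha_1\alpha_0^2\beta_1^2 - 3\alpha_1\alpha_0^2\beta_0^2 - 9B\alpha_1\alpha_0^2 + 4A\alpha_1\alpha_0\beta_1^2\beta_0 + 2A^2\alpha_1\alpha_0\beta_1 + 6\alpha_1\alpha_0\beta_0^3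 + 18B\alpha_1\alpha_0\beta_0 + 2A^2\alpha_1\beta_1\beta_0 + 9B\alpha_1\beta_0^2 + (4A^3 + 27B^2)\alpha_1 + 6\alpha_0^3\beta_1\beta_0 + A\alpha_0^3 - 2A\alpha_0^2\beta_1^3 - 3\alpha_0^2\beta_1\beta_0^2 + 9B\alpha_0^2\beta_1 - 9A\alpha_0^2\beta_0 + A^2\alpha_0\beta_1^2 + 18B\alpha_0\beta_1\beta_0 - 9A\alpha_0\beta_0^2 + 2AB\beta_1^3 - 3A^2\beta_1^2\beta_0 - 9B\beta_1\beta_0^2 + (4A^3 + 27B^2)\beta_1 + A\beta_0^3$ $b_0 = -2A^2\alpha_1^3\beta_1\beta_0 - 8B\alpha_1^3\beta_0^2 + (A^3 + 8B^2)\alpha_1^3 + A^2\alpha_1^2\alpha_0\beta_1^2 - 8B\alpha_1^2\alpha_0\beta_1\beta_0 + 6A\alpha_1^2\alpha_0\beta_0^2 - 2AB\alpha_1^2\alpha_0 + A^2\alpha_1^2\beta_1^2\beta_0 + 4B\alpha_1^2\beta_1\beta_0^2 + (-A^3 - 12B^2)\alpha_1^2\beta_1 + 4AB\alpha_1^2\beta_0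 + 4B\alpha_1\alpha_0^2\beta_1^2 + A^2\alpha_1\alpha_0^2 - 2A^2\alpha_1\alpha_0\beta_1^3 - 8B\alpha_1\alpha_0\beta_1^2\beta_0 + 8AB\alpha_1\alpha_0\beta_1 - 6A^2\alpha_1\alpha_0\beta_0 + (-A^3 - 12B^2)\alpha_1\beta_1^2 + 8AB\alpha_1\beta_1\beta_0 - 3A^2\alpha_1\beta_0^2 + 3\alpha_0^3\beta_0^2 + B\alpha_0^3 - 8B\alpha_0^2\beta_1^3 + 6A\alpha_0^2\beta_1^2\beta_0 - 3A^2\alpha_0^2\beta_1 + 3\alpha_0^2\beta_0^3 - 15B\alpha_0^2\beta_0 + 4AB\alpha_0\beta_1^2 - 6A^2\alpha_0\beta_1\beta_0 - 15B\alpha_0\beta_0^2 + (4A^3 + 27B^2)\alpha_0 + (A^3 + 8B^2)\beta_1^3 - 2AB\beta_1^2\beta_0 + A^2\beta_1\beta_0^2 + B\beta_0^3 + (4A^3 + 27B^2)\beta_0$ **Formulas (2)** for the coefficients of $h_{2P}$: $u_1 = 4B\alpha_1^4 - 4A\alpha_1^3\alpha_0 + 4A^2\alpha_1^2 - 4\alpha_1\alpha_0^3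 + 36B\alpha_1\alpha_0 - 12A\alpha_0^2$ $u_0 = -A^2\alpha_1^4 - 8B\alpha_1^3\alpha_0 + 2A\alpha_1^2\alpha_0^2 + 6AB\alpha_1^2 - 8A^2\alpha_1\alpha_0 - \alpha_0^4 - 18B\alpha_0^2 + 4A^3 + 27B^2$ $c = 8B\alpha_1^3 - 8A\alpha_1^2\alpha_0 - 8\alpha_0^3$ -/

import Mathlib

open Polynomial
open scoped Polynomial.Bivariate

namespace TraceZero

/-! ## Data of the procedure -/

/-- The input of the procedure over a commutative ring `k`: the curve `y² = x³ + A x + B` and two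
lines `h_P = y - (α₁ x + α₀)`, `h_Q = y - (β₁ x + β₀)`. -/
structure LinePair (k : Type*) where
  A : k
  B : k
  α₁ : k
  α₀ : k
  β₁ : k
  β₀ : k

section Procedure

variable {k : Type*} [CommRing k]

/-- The coefficient of `S_{P,Q}` called `a₄`. -/
def a₄ : LinePair k → k := fun ⟨A, B, α₁, α₀, β₁, β₀⟩ =>
    -α₁^3 * β₁ * β₀^2 - 3 * B * α₁^3 * β₁ + 2 * A * α₁^3 * β₀ + 2 * α₁^2 * α₀ * β₁^2 * β₀ +
    A * α₁^2 * α₀ * β₁ - 6 * B * α₁^2 * β₁^2 + 3 * A * α₁^2 * β₁ * β₀ + A^2 * α₁^2 - α₁ *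
    α₀^2 * β₁^3 + 6 * α₁ * α₀^2 * β₀ + 3 * A * α₁ * α₀ * β₁^2 + 3 * α₁ * α₀ * β₀^2 + 9 * B *
    α₁ * α₀ - 3 * B * α₁ * β₁^3 + A * α₁ * β₁^2 * β₀ + 2 * A^2 * α₁ * β₁ - 3 * α₁ * β₀^3 + 9
    * B * α₁ * β₀ - 3 * α₀^3 * β₁ + 3 * α₀^2 * β₁ * β₀ - 3 * A * α₀^2 + 2 * A * α₀ * β₁^3 +
    6 * α₀ * β₁ * β₀^2 + 9 * B * α₀ * β₁ - 6 * A * α₀ * β₀ + A^2 * β₁^2 + 9 * B * β₁ * β₀ -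
    3 * A * β₀^2

/-- The coefficient of `S_{P,Q}` called `a₃`. -/
def a₃ : LinePair k → k := fun ⟨A, B, α₁, α₀, β₁, β₀⟩ =>
    4 * B * α₁^3 * β₁^3 - 2 * A * α₁^3 * β₁^2 * β₀ + A^2 * α₁^3 * β₁ - α₁^3 * β₀^3 + 9 * B *
    α₁^3 * β₀ - 2 * A * α₁^2 * α₀ * β₁^3 - α₁^2 * α₀ * β₁ * β₀^2 + 3 * B * α₁^2 * α₀ * β₁ -
    7 * A * α₁^2 * α₀ * β₀ + A^2 * α₁^2 * β₁^2 - 6 * B * α₁^2 * β₁ * β₀ + 3 * A * α₁^2 *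
    β₀^2 + 6 * A * B * α₁^2 - α₁ * α₀^2 * β₁^2 * β₀ + A * α₁ * α₀^2 * β₁ - 6 * B * α₁ * α₀ *
    β₁^2 + 12 * A * α₁ * α₀ * β₁ * β₀ - 8 * A^2 * α₁ * α₀ + A^2 * α₁ * β₁^3 + 3 * B * α₁ *
    β₁^2 * β₀ + A * α₁ * β₁ * β₀^2 - 6 * A * B * α₁ * β₁ + 4 * A^2 * α₁ * β₀ - α₀^3 * β₁^3 -
    3 * α₀^3 * β₀ + 3 * A * α₀^2 * β₁^2 + 21 * α₀^2 * β₀^2 - 18 * B * α₀^2 + 9 * B * α₀ *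
    β₁^3 - 7 * A * α₀ * β₁^2 * β₀ + 4 * A^2 * α₀ * β₁ - 3 * α₀ * β₀^3 + 18 * B * α₀ * β₀ + 6
    * A * B * β₁^2 - 8 * A^2 * β₁ * β₀ - 18 * B * β₀^2 + 4 * A^3 + 27 * B^2

/-- The coefficient of `S_{P,Q}` called `a₂`. -/
def a₂ : LinePair k → k := fun ⟨A, B, α₁, α₀, β₁, β₀⟩ =>
    -A^2 * α₁^3 * β₁^3 - 2 * A * α₁^3 * β₁ * β₀^2 - 6 * A * B * α₁^3 * β₁ + A^2 * α₁^3 * β₀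
    - 2 * A * α₁^2 * α₀ * β₁^2 * β₀ + 5 * A^2 * α₁^2 * α₀ * β₁ - 3 * α₁^2 * α₀ * β₀^3 - 9 *
    B * α₁^2 * α₀ * β₀ + 6 * A * B * α₁^2 * β₁^2 + 9 * B * α₁^2 * β₀^2 + (2 * A^3 + 27 *
    B^2) * α₁^2 - 2 * A * α₁ * α₀^2 * β₁^3 - 3 * α₁ * α₀^2 * β₁ * β₀^2 + 9 * B * α₁ * α₀^2 *
    β₁ + 9 * A * α₁ * α₀^2 * β₀ + 36 * B * α₁ * α₀ * β₁ * β₀ - 12 * A * α₁ * α₀ * β₀^2 - 18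
    * A * B * α₁ * α₀ - 6 * A * B * α₁ * β₁^3 + 5 * A^2 * α₁ * β₁^2 * β₀ + 9 * B * α₁ * β₁ *
    β₀^2 + (4 * A^3 - 27 * B^2) * α₁ * β₁ - 3 * A * α₁ * β₀^3 + 36 * A * B * α₁ * β₀ - 3 *
    α₀^3 * β₁^2 * β₀ - 3 * A * α₀^3 * β₁ + 9 * B * α₀^2 * β₁^2 - 12 * A * α₀^2 * β₁ * β₀ + 6
    * A^2 * α₀^2 + A^2 * α₀ * β₁^3 - 9 * B * α₀ * β₁^2 * β₀ + 9 * A * α₀ * β₁ * β₀^2 + 36 *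
    A * B * α₀ * β₁ - 24 * A^2 * α₀ * β₀ + (2 * A^3 + 27 * B^2) * β₁^2 - 18 * A * B * β₁ *
    β₀ + 6 * A^2 * β₀^2

/-- The coefficient of `S_{P,Q}` called `a₁`. -/
def a₁ : LinePair k → k := fun ⟨A, B, α₁, α₀, β₁, β₀⟩ =>
    -A^2 * α₁^3 * β₁^2 * β₀ - 4 * B * α₁^3 * β₁ * β₀^2 + (A^3 - 12 * B^2) * α₁^3 * β₁ + 8 *
    A * B * α₁^3 * β₀ - A^2 * α₁^2 * α₀ * β₁^3 - 4 * B * α₁^2 * α₀ * β₁^2 * β₀ + 16 * A * B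
    * α₁^2 * α₀ * β₁ - 3 * A^2 * α₁^2 * α₀ * β₀ + (-3 * A^3 + 12 * B^2) * α₁^2 * β₁^2 - 24 *
    A * B * α₁^2 * β₁ * β₀ + 3 * A^2 * α₁^2 * β₀^2 - 2 * A^2 * B * α₁^2 - 4 * B * α₁ * α₀^2
    * β₁^3 - 3 * A^2 * α₁ * α₀^2 * β₁ - 3 * α₁ * α₀^2 * β₀^3 + 15 * B * α₁ * α₀^2 * β₀ - 24
    * A * B * α₁ * α₀ * β₁^2 + 12 * A^2 * α₁ * α₀ * β₁ * β₀ - 6 * B * α₁ * α₀ * β₀^2 - 18 *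
    B^2 * α₁ * α₀ + (A^3 - 12 * B^2) * α₁ * β₁^3 + 16 * A * B * α₁ * β₁^2 * β₀ - 3 * A^2 *
    α₁ * β₁ * β₀^2 + 14 * A^2 * B * α₁ * β₁ - 3 * B * α₁ * β₀^3 + 63 * B^2 * α₁ * β₀ - 3 *
    α₀^3 * β₁ * β₀^2 - 3 * B * α₀^3 * β₁ - 3 * A * α₀^3 * β₀ + 3 * A^2 * α₀^2 * β₁^2 - 6 * B
    * α₀^2 * β₁ * β₀ + 9 * A * α₀^2 * β₀^2 + 6 * A * B * α₀^2 + 8 * A * B * α₀ * β₁^3 - 3 *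
    A^2 * α₀ * β₁^2 * β₀ + 15 * B * α₀ * β₁ * β₀^2 + 63 * B^2 * α₀ * β₁ - 3 * A * α₀ * β₀^3
    - 42 * A * B * α₀ * β₀ - 2 * A^2 * B * β₁^2 - 18 * B^2 * β₁ * β₀ + 6 * A * B * β₀^2 + 4
    * A^4 + 27 * A * B^2

/-- The coefficient of `S_{P,Q}` called `a₀`. -/
def a₀ : LinePair k → k := fun ⟨A, B, α₁, α₀, β₁, β₀⟩ =>
    2 * A^2 * B * α₁^3 * β₁ - A^3 * α₁^3 * β₀ - A^2 * α₁^2 * α₀ * β₁^2 * β₀ - 4 * B * α₁^2 *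
    α₀ * β₁ * β₀^2 + 12 * B^2 * α₁^2 * α₀ * β₁ - 4 * A * B * α₁^2 * α₀ * β₀ - 5 * A^2 * B *
    α₁^2 * β₁^2 + (A^3 - 24 * B^2) * α₁^2 * β₁ * β₀ + 6 * A * B * α₁^2 * β₀^2 + (A^4 + 6 * A
    * B^2) * α₁^2 - 4 * B * α₁ * α₀^2 * β₁^2 * β₀ + 2 * A * α₁ * α₀^2 * β₁ * β₀^2 - 2 * A *
    B * α₁ * α₀^2 * β₁ - A^2 * α₁ * α₀^2 * β₀ + (A^3 - 24 * B^2) * α₁ * α₀ * β₁^2 + 24 * A *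
    B * α₁ * α₀ * β₁ * β₀ - 3 * A^2 * α₁ * α₀ * β₀^2 + A^2 * B * α₁ * α₀ + 2 * A^2 * B * α₁
    * β₁^3 + 12 * B^2 * α₁ * β₁^2 * β₀ - 2 * A * B * α₁ * β₁ * β₀^2 + (-2 * A^4 - 6 * A *
    B^2) * α₁ * β₁ - 5 * A^2 * B * α₁ * β₀ - α₀^3 * β₀^3 - 3 * B * α₀^3 * β₀ + 6 * A * B *
    α₀^2 * β₁^2 - 3 * A^2 * α₀^2 * β₁ * β₀ + 3 * B * α₀^2 * β₀^2 + (A^3 + 9 * B^2) * α₀^2 -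
    A^3 * α₀ * β₁^3 - 4 * A * B * α₀ * β₁^2 * β₀ - A^2 * α₀ * β₁ * β₀^2 - 5 * A^2 * B * α₀ *
    β₁ - 3 * B * α₀ * β₀^3 + (2 * A^3 - 9 * B^2) * α₀ * β₀ + (A^4 + 6 * A * B^2) * β₁^2 +
    A^2 * B * β₁ * β₀ + (A^3 + 9 * B^2) * β₀^2 + 4 * A^3 * B + 27 * B^3

/-- The coefficient of `S_{P,Q}` called `b₃`. -/
def b₃ : LinePair k → k := fun ⟨A, B, α₁, α₀, β₁, β₀⟩ =>
    α₁^3 * β₀^2 - B * α₁^3 - 2 * α₁^2 * α₀ * β₁ * β₀ + A * α₁^2 * α₀ + α₁^2 * β₁ * β₀^2 - 3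
    * B * α₁^2 * β₁ + A * α₁^2 * β₀ + α₁ * α₀^2 * β₁^2 - 2 * α₁ * α₀ * β₁^2 * β₀ + 2 * A *
    α₁ * α₀ * β₁ - 3 * B * α₁ * β₁^2 + 2 * A * α₁ * β₁ * β₀ + α₀^3 + α₀^2 * β₁^3 + 3 * α₀^2
    * β₀ + A * α₀ * β₁^2 + 3 * α₀ * β₀^2 - B * β₁^3 + A * β₁^2 * β₀ + β₀^3

/-- The coefficient of `S_{P,Q}` called `b₂`. -/
def b₂ : LinePair k → k := fun ⟨A, B, α₁, α₀, β₁, β₀⟩ =>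
    A^2 * α₁^3 + 3 * α₁^2 * α₀ * β₀^2 + 9 * B * α₁^2 * α₀ + 3 * A^2 * α₁^2 * β₁ + 3 * α₁^2 *
    β₀^3 + 9 * B * α₁^2 * β₀ - 6 * α₁ * α₀^2 * β₁ * β₀ - 3 * A * α₁ * α₀^2 - 6 * α₁ * α₀ *
    β₁ * β₀^2 + 18 * B * α₁ * α₀ * β₁ - 6 * A * α₁ * α₀ * β₀ + 3 * A^2 * α₁ * β₁^2 + 18 * B
    * α₁ * β₁ * β₀ - 3 * A * α₁ * β₀^2 + 3 * α₀^3 * β₁^2 + 3 * α₀^2 * β₁^2 * β₀ - 3 * A *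
    α₀^2 * β₁ + 9 * B * α₀ * β₁^2 - 6 * A * α₀ * β₁ * β₀ + A^2 * β₁^3 + 9 * B * β₁^2 * β₀ -
    3 * A * β₁ * β₀^2

/-- The coefficient of `S_{P,Q}` called `b₁`. -/
def b₁ : LinePair k → k := fun ⟨A, B, α₁, α₀, β₁, β₀⟩ =>
    -A^2 * α₁^3 * β₁^2 - 2 * A * α₁^3 * β₀^2 + 2 * A * B * α₁^3 - 12 * B * α₁^2 * α₀ * β₁^2
    + 4 * A * α₁^2 * α₀ * β₁ * β₀ - 3 * A^2 * α₁^2 * α₀ - A^2 * α₁^2 * β₁^3 - 12 * B * α₁^2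
    * β₁^2 * β₀ + 4 * A * α₁^2 * β₁ * β₀^2 + A^2 * α₁^2 * β₀ + 4 * A * α₁ * α₀^2 * β₁^2 - 3
    * α₁ * α₀^2 * β₀^2 - 9 * B * α₁ * α₀^2 + 4 * A * α₁ * α₀ * β₁^2 * β₀ + 2 * A^2 * α₁ * α₀
    * β₁ + 6 * α₁ * α₀ * β₀^3 + 18 * B * α₁ * α₀ * β₀ + 2 * A^2 * α₁ * β₁ * β₀ + 9 * B * α₁
    * β₀^2 + (4 * A^3 + 27 * B^2) * α₁ + 6 * α₀^3 * β₁ * β₀ + A * α₀^3 - 2 * A * α₀^2 * β₁^3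
    - 3 * α₀^2 * β₁ * β₀^2 + 9 * B * α₀^2 * β₁ - 9 * A * α₀^2 * β₀ + A^2 * α₀ * β₁^2 + 18 *
    B * α₀ * β₁ * β₀ - 9 * A * α₀ * β₀^2 + 2 * A * B * β₁^3 - 3 * A^2 * β₁^2 * β₀ - 9 * B *
    β₁ * β₀^2 + (4 * A^3 + 27 * B^2) * β₁ + A * β₀^3

/-- The coefficient of `S_{P,Q}` called `b₀`. -/
def b₀ : LinePair k → k := fun ⟨A, B, α₁, α₀, β₁, β₀⟩ =>
    -2 * A^2 * α₁^3 * β₁ * β₀ - 8 * B * α₁^3 * β₀^2 + (A^3 + 8 * B^2) * α₁^3 + A^2 * α₁^2 *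
    α₀ * β₁^2 - 8 * B * α₁^2 * α₀ * β₁ * β₀ + 6 * A * α₁^2 * α₀ * β₀^2 - 2 * A * B * α₁^2 *
    α₀ + A^2 * α₁^2 * β₁^2 * β₀ + 4 * B * α₁^2 * β₁ * β₀^2 + (-A^3 - 12 * B^2) * α₁^2 * β₁ +
    4 * A * B * α₁^2 * β₀ + 4 * B * α₁ * α₀^2 * β₁^2 + A^2 * α₁ * α₀^2 - 2 * A^2 * α₁ * α₀ *
    β₁^3 - 8 * B * α₁ * α₀ * β₁^2 * β₀ + 8 * A * B * α₁ * α₀ * β₁ - 6 * A^2 * α₁ * α₀ * β₀ +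
    (-A^3 - 12 * B^2) * α₁ * β₁^2 + 8 * A * B * α₁ * β₁ * β₀ - 3 * A^2 * α₁ * β₀^2 + 3 *
    α₀^3 * β₀^2 + B * α₀^3 - 8 * B * α₀^2 * β₁^3 + 6 * A * α₀^2 * β₁^2 * β₀ - 3 * A^2 * α₀^2
    * β₁ + 3 * α₀^2 * β₀^3 - 15 * B * α₀^2 * β₀ + 4 * A * B * α₀ * β₁^2 - 6 * A^2 * α₀ * β₁
    * β₀ - 15 * B * α₀ * β₀^2 + (4 * A^3 + 27 * B^2) * α₀ + (A^3 + 8 * B^2) * β₁^3 - 2 * A *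
    B * β₁^2 * β₀ + A^2 * β₁ * β₀^2 + B * β₀^3 + (4 * A^3 + 27 * B^2) * β₀

/-- The coefficient of `h_{2P}` called `u₁`. -/
def u₁ : LinePair k → k := fun ⟨A, B, α₁, α₀, _, _⟩ =>
    4 * B * α₁^4 - 4 * A * α₁^3 * α₀ + 4 * A^2 * α₁^2 - 4 * α₁ * α₀^3 + 36 * B * α₁ * α₀ -
    12 * A * α₀^2

/-- The coefficient of `h_{2P}` called `u₀`. -/
def u₀ : LinePair k → k := fun ⟨A, B, α₁, α₀, _, _⟩ =>
    -A^2 * α₁^4 - 8 * B * α₁^3 * α₀ + 2 * A * α₁^2 * α₀^2 + 6 * A * B * α₁^2 - 8 * A^2 * α₁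
    * α₀ - α₀^4 - 18 * B * α₀^2 + 4 * A^3 + 27 * B^2

/-- The coefficient of `h_{2P}` called `c`. -/
def c : LinePair k → k := fun ⟨A, B, α₁, α₀, _, _⟩ =>
    8 * B * α₁^3 - 8 * A * α₁^2 * α₀ - 8 * α₀^3

/-- `f(x) = x³ + A x + B`. -/
noncomputable def cubic (A B : k) : k[X] := X ^ 3 + C A * X + C B

/-- The modulus `y² - f(x)`. -/
noncomputable def modulus (A B : k) : k[X][Y] := Y ^ 2 - C (cubic A B)

/-- The polynomial `y - (m₁ x + m₀)`. -/
noncomputable def line (m₁ m₀ : k) : k[X][Y] := Y - C (C m₁ * X + C m₀)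

/-- The polynomial `g(x, -y)`. -/
noncomputable def conjY (g : k[X][Y]) : k[X][Y] := g.comp (-X)

/-! ## The formulas -/

/-- `(S_{P,Q})₁ = a₄x⁴ + a₃x³ + a₂x² + a₁x + a₀`. -/
noncomputable def sumPart₁ (D : LinePair k) : k[X] :=
  C (a₄ D) * X ^ 4 + C (a₃ D) * X ^ 3 + C (a₂ D) * X ^ 2 + C (a₁ D) * X + C (a₀ D)

/-- `(S_{P,Q})₂ = b₃x³ + b₂x² + b₁x + b₀`. -/
noncomputable def sumPart₂ (D : LinePair k) : k[X] :=
  C (b₃ D) * X ^ 3 + C (b₂ D) * X ^ 2 + C (b₁ D) * X + C (b₀ D)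

/-- `S_{P,Q} = (S_{P,Q})₁ + y (S_{P,Q})₂`, as given by the formulas. -/
noncomputable def sumFormula (D : LinePair k) : k[X][Y] := C (sumPart₁ D) + Y * C (sumPart₂ D)

/-- `h_{2P} = c y - (u₀ + u₁ x)`, as given by the formulas. -/
noncomputable def doublingFormula (D : LinePair k) : k[X][Y] :=
  C (C (c D)) * Y - C (C (u₀ D) + C (u₁ D) * X)

/-! ## The procedure -/

/-- The variables `x_{P_i}, y_{P_i}, x_{Q_i}, y_{Q_i}, x, y`. -/
inductive Var
  | xP (i : Fin 3)
  | yP (i : Fin 3)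
  | xQ (i : Fin 3)
  | yQ (i : Fin 3)
  | x
  | y

/-- The variables `e_i, s_i, x, y` (indices shifted by one: `e 0, e 1, e 2` are `e₁, e₂, e₃`). -/
inductive SymVar
  | e (i : Fin 3)
  | s (i : Fin 3)
  | x
  | y

/-- A variable, as a polynomial. -/
noncomputable abbrev var (v : Var) : MvPolynomial Var k := MvPolynomial.X v

/-- The tangent
`t_i = f'(x_{P_i}) x - 2 y_{P_i} y + (2 y_{P_i}² - f'(x_{P_i}) x_{P_i})`. -/
noncomputable def tangent (D : LinePair k) (i : Fin 3) : MvPolynomial Var k :=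
  aeval (var (.xP i)) (derivative (cubic D.A D.B)) * var .x - 2 * var (.yP i) * var .y
    + (2 * var (.yP i) ^ 2 - aeval (var (.xP i)) (derivative (cubic D.A D.B)) * var (.xP i))

variable (k) in
/-- The chord `r_{ij} = (y_{Q_j} - y_{P_i}) x + (x_{P_i} - x_{Q_j}) y
  + ((x_{Q_j} - x_{P_i}) y_{P_i} + (y_{P_i} - y_{Q_j}) x_{P_i})`. -/
noncomputable def chord (i j : Fin 3) : MvPolynomial Var k :=
  (var (.yQ j) - var (.yP i)) * var .x + (var (.xP i) - var (.xQ j)) * var .y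
    + ((var (.xQ j) - var (.xP i)) * var (.yP i) + (var (.yP i) - var (.yQ j)) * var (.xP i))

/-- `T = t₁ t₂ t₃`. -/
noncomputable def tangentProduct (D : LinePair k) : MvPolynomial Var k := ∏ i, tangent D i

variable (k) in
/-- `R = ∏_{i,j} r_{ij}`. -/
noncomputable def chordProduct : MvPolynomial Var k := ∏ i, ∏ j, chord k i j

/-- Replace `y_{P_i}` by `α₁ x_{P_i} + α₀` and `y_{Q_i}` by `β₁ x_{Q_i} + β₀`. -/
noncomputable def substY (D : LinePair k) : MvPolynomial Var k →ₐ[k] MvPolynomial Var k :=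
  MvPolynomial.bind₁ fun
    | .yP i => MvPolynomial.C D.α₁ * var (.xP i) + MvPolynomial.C D.α₀
    | .yQ i => MvPolynomial.C D.β₁ * var (.xQ i) + MvPolynomial.C D.β₀
    | v => var v

variable (k) in
/-- Expand `e_i` as the `i`-th elementary symmetric polynomial in `x_{P_1}, x_{P_2}, x_{P_3}`, and
`s_i` as the `i`-th elementary symmetric polynomial in `x_{Q_1}, x_{Q_2}, x_{Q_3}`. -/
noncomputable def expand : MvPolynomial SymVar k →ₐ[k] MvPolynomial Var k :=
  MvPolynomial.aeval fun
    | .e i => MvPolynomial.rename Var.xP (MvPolynomial.esymm (Fin 3) k (i + 1))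
    | .s i => MvPolynomial.rename Var.xQ (MvPolynomial.esymm (Fin 3) k (i + 1))
    | .x => var .x
    | .y => var .y

/-- The values `E₁ = α₁²`, `E₂ = A - 2 α₀ α₁`, `E₃ = α₀² - B`. -/
def valueE (D : LinePair k) : Fin 3 → k := ![D.α₁ ^ 2, D.A - 2 * D.α₀ * D.α₁, D.α₀ ^ 2 - D.B]

/-- The values `S₁ = β₁²`, `S₂ = A - 2 β₀ β₁`, `S₃ = β₀² - B`. -/
def valueS (D : LinePair k) : Fin 3 → k := ![D.β₁ ^ 2, D.A - 2 * D.β₀ * D.β₁, D.β₀ ^ 2 - D.B]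

/-- Replace `e_i` by `E_i` and `s_i` by `S_i`, leaving a polynomial in `x, y`. -/
noncomputable def substES (D : LinePair k) : MvPolynomial SymVar k →ₐ[k] k[X][Y] :=
  MvPolynomial.aeval fun
    | .e i => C (C (valueE D i))
    | .s i => C (C (valueS D i))
    | .x => C X
    | .y => Y

/-- `t` is what the polynomial `p` (which will be `T` or `R`) becomes when the `y`-coordinates are
replaced, the result is written as a polynomial in `e_i, s_i, x, y`, and `e_i, s_i` are replaced by
`E_i, S_i`. -/
def IsOutput (D : LinePair k) (p : MvPolynomial Var k) (t : k[X][Y]) : Prop :=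
  ∃ g : MvPolynomial SymVar k, expand k g = substY D p ∧ t = substES D g

/-- `p` and `q` agree modulo `y² - f(x)`, up to multiplication of `q` by a nonzero constant. -/
def EqUpToConst (D : LinePair k) (p q : k[X][Y]) : Prop :=
  ∃ κ : k, κ ≠ 0 ∧ modulus D.A D.B ∣ p - C (C κ) * q

end Procedure

/-- The input with indeterminate line coefficients `α₁, α₀, β₁, β₀`, on a fixed curve. -/
noncomputable def symbolic {F : Type*} [CommRing F] (A B : F) :
    LinePair (MvPolynomial (Fin 4) F) :=
  ⟨.C A, .C B, .X 0, .X 1, .X 2, .X 3⟩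

/-! ## The curve, the Frobenius endomorphism and divisors -/

section Curve

variable {F : Type*} [Field F]

/-- The curve `E : y² = x³ + A x + B`. -/
def curve (A B : F) : WeierstrassCurve.Affine F := ⟨0, 0, 0, A, B⟩

/-- The group `E(K)`. -/
abbrev Pt (K : Type*) [Field K] [Algebra F K] (A B : F) : Type _ :=
  ((curve A B).baseChange K).Point

variable {K : Type*} [Field K] [Algebra F K] {A B : F}

/-- The Frobenius endomorphism `(x, y) ↦ (x ^ q, y ^ q)` of `E(K)`, where `q = #F`. -/
noncomputable def frob [Fintype F] [DecidableEq K] : Pt K A B →+ Pt K A B :=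
  WeierstrassCurve.Affine.Point.map (W' := curve A B) (FiniteField.frobeniusAlgHom F K)

/-- `P` has trace zero: `P + φ(P) + φ²(P) = P_∞`. -/
def TraceZeroPoint [Fintype F] [DecidableEq K] (P : Pt K A B) : Prop :=
  P + frob P + frob (frob P) = 0

/-- The ideal of the coordinate ring `K[E]` of functions vanishing at a point; the unit ideal for
the point at infinity, which does not lie on the affine curve. -/
noncomputable def pointIdeal : Pt K A B → Ideal ((curve A B).baseChange K).CoordinateRing
  | .zero => ⊤
  | .some x y _ => WeierstrassCurve.Affine.CoordinateRing.XYIdeal _ x (C y)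

/-- `div(g) = ∑ᵢ Dᵢ - n P_∞` on `E`, where `n` is the number of points `Dᵢ`: the ideal generated by
`g` in the Dedekind domain `K[E]` is the product of the ideals of the points `Dᵢ`. (This fixes the
multiplicity of every zero of `g` on the affine curve; the multiplicity at `P_∞` is then
the one that makes the degree zero.) -/
def HasDivisor {ι : Type*} [Fintype ι] (g : F[X][Y]) (D : ι → Pt K A B) : Prop :=
  Ideal.span {WeierstrassCurve.Affine.CoordinateRing.mk ((curve A B).baseChange K)
    (g.map (mapRingHom (algebraMap F K)))} = ∏ i, pointIdeal (D i)

variable [Fintype F] [DecidableEq K]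

/-- The points `P, φ(P), φ²(P)`. -/
noncomputable def orbit (P : Pt K A B) (i : Fin 3) : Pt K A B := frob^[i] P

/-- `h_P = y - (m₁ x + m₀)`: this is the line through `P, φ(P), φ²(P)`, counted with multiplicity,
i.e. its divisor is `P + φ(P) + φ²(P) - 3 P_∞`. -/
def IsLineOf (P : Pt K A B) (m₁ m₀ : F) : Prop := HasDivisor (line m₁ m₀) (orbit P)

/-- The points `φⁱ(P) + φʲ(Q)`, `0 ≤ i, j ≤ 2`. -/
noncomputable def sums (P Q : Pt K A B) (ij : Fin 3 × Fin 3) : Pt K A B :=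
  orbit P ij.1 + orbit Q ij.2

end Curve

end TraceZero

open TraceZero

/-!
Let `v` be a point of the curve. The line through `v` and a point `Pᵢ` of `h_P = 0` meets the curve
again at `Rᵢ = -(v + Pᵢ)`. As `Q₁, Q₂, Q₃` are the zeros of `h_Q`, Weil reciprocity turns the
product over `j` of the equations of the lines `PᵢQⱼ` at `v` into a product of `h_Q(v)`, `h_Q(Pᵢ)`
and `h_Q(Rᵢ)`. Multiplying over `i` gives `h_Q(v)³` times the constant `∏ h_Q(Pᵢ)` times
`∏ h_Q(Rᵢ)`, and clearing denominators in the last product leaves `h_P(v)³ S_{P,Q}(-v)`. With `v`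
moved to the origin this becomes a polynomial identity over any commutative ring, which yields the
formulas.

As for divisors, the tangent at `Pᵢ` has divisor `2Pᵢ + (-2Pᵢ) - 3P_∞`, the line `PᵢQⱼ` has divisor
`Pᵢ + Qⱼ + (-(Pᵢ + Qⱼ)) - 3P_∞`, and a divisor determines a function up to a constant. The argument
for the chords needs `Pᵢ ≠ Qⱼ`. If the two lines agree, the identity
`S_{P,P} = -h_{-P}² h_{2P}` modulo `y² - f(x)` gives the divisor instead. For Frobenius orbits these
are the only two cases, since orbits that meet have the same line.
-/

namespace TraceZero

/-! ### Norms along a cubic -/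

section Norm

variable {S S' : Type*} [CommRing S] [CommRing S']

/-- The elementary symmetric functions of three elements. -/
def elemSymm (z : Fin 3 → S) : Fin 3 → S :=
  ![z 0 + z 1 + z 2, z 0 * z 1 + z 0 * z 2 + z 1 * z 2, z 0 * z 1 * z 2]

/-- The norm of `a + b z + c z²` from `S[z] / (z³ - e₀ z² + e₁ z - e₂)` to `S`. -/
def quadNorm (e : Fin 3 → S) (a b c : S) : S :=
  a ^ 3 + a ^ 2 * b * e 0 + a ^ 2 * c * (e 0 ^ 2 - 2 * e 1) + a * b ^ 2 * e 1
    + a * b * c * (e 0 * e 1 - 3 * e 2) + a * c ^ 2 * (e 1 ^ 2 - 2 * e 0 * e 2) + b ^ 3 * e 2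
    + b ^ 2 * c * e 0 * e 2 + b * c ^ 2 * e 1 * e 2 + c ^ 3 * e 2 ^ 2

/-- The norm of `c₀ + c₁ z + c₂ z² + c₃ z³` from `S[z] / (z³ - e₀ z² + e₁ z - e₂)` to `S`. -/
def cubicNorm (e : Fin 3 → S) (c₀ c₁ c₂ c₃ : S) : S :=
  quadNorm e (c₀ + c₃ * e 2) (c₁ - c₃ * e 1) (c₂ + c₃ * e 0)

/-- The product of `(u₀ + u₁ z) w + (v₀ + v₁ z)` over the roots `z` and `w` of the monic cubics
whose roots have elementary symmetric functions `e` and `s`. -/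
def bilinearNorm (e s : Fin 3 → S) (u₀ u₁ v₀ v₁ : S) : S :=
  cubicNorm e (u₀ ^ 3 * s 2 + u₀ ^ 2 * v₀ * s 1 + u₀ * v₀ ^ 2 * s 0 + v₀ ^ 3)
    (3 * u₀ ^ 2 * u₁ * s 2 + (2 * u₀ * u₁ * v₀ + u₀ ^ 2 * v₁) * s 1
      + (u₁ * v₀ ^ 2 + 2 * u₀ * v₀ * v₁) * s 0 + 3 * v₀ ^ 2 * v₁)
    (3 * u₀ * u₁ ^ 2 * s 2 + (u₁ ^ 2 * v₀ + 2 * u₀ * u₁ * v₁) * s 1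
      + (2 * u₁ * v₀ * v₁ + u₀ * v₁ ^ 2) * s 0 + 3 * v₀ * v₁ ^ 2)
    (u₁ ^ 3 * s 2 + u₁ ^ 2 * v₁ * s 1 + u₁ * v₁ ^ 2 * s 0 + v₁ ^ 3)

/-- The elementary symmetric functions of `zᵢ - x`, where those of the `zᵢ` are `e`. -/
def shift (e : Fin 3 → S) (x : S) : Fin 3 → S :=
  ![e 0 - 3 * x, e 1 - 2 * x * e 0 + 3 * x ^ 2, e 2 - x * e 1 + x ^ 2 * e 0 - x ^ 3]

theorem map_elemSymm (f : S →+* S') (z : Fin 3 → S) (i : Fin 3) :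
    f (elemSymm z i) = elemSymm (f ∘ z) i := by
  fin_cases i <;> simp [elemSymm]

theorem map_quadNorm (f : S →+* S') (e : Fin 3 → S) (a b c : S) :
    f (quadNorm e a b c) = quadNorm (f ∘ e) (f a) (f b) (f c) := by
  simp [quadNorm, map_ofNat f]

theorem map_cubicNorm (f : S →+* S') (e : Fin 3 → S) (c₀ c₁ c₂ c₃ : S) :
    f (cubicNorm e c₀ c₁ c₂ c₃) = cubicNorm (f ∘ e) (f c₀) (f c₁) (f c₂) (f c₃) := by
  simp [cubicNorm, map_quadNorm]

theorem map_bilinearNorm (f : S →+* S') (e s : Fin 3 → S) (u₀ u₁ v₀ v₁ : S) :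
    f (bilinearNorm e s u₀ u₁ v₀ v₁) =
      bilinearNorm (f ∘ e) (f ∘ s) (f u₀) (f u₁) (f v₀) (f v₁) := by
  simp [bilinearNorm, map_cubicNorm, map_ofNat f]

theorem quadNorm_elemSymm (z : Fin 3 → S) (a b c : S) :
    quadNorm (elemSymm z) a b c = ∏ i, (a + b * z i + c * z i ^ 2) := by
  simp only [quadNorm, elemSymm, Fin.prod_univ_three, Matrix.cons_val]
  ring

theorem cubicNorm_elemSymm (z : Fin 3 → S) (c₀ c₁ c₂ c₃ : S) :
    cubicNorm (elemSymm z) c₀ c₁ c₂ c₃ =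
      ∏ i, (c₀ + c₁ * z i + c₂ * z i ^ 2 + c₃ * z i ^ 3) := by
  rw [cubicNorm, quadNorm_elemSymm, Fin.prod_univ_three, Fin.prod_univ_three]
  simp only [elemSymm, Matrix.cons_val]
  congr 1
  · congr 1 <;> ring
  · ring

theorem bilinearNorm_elemSymm (z w : Fin 3 → S) (u₀ u₁ v₀ v₁ : S) :
    bilinearNorm (elemSymm z) (elemSymm w) u₀ u₁ v₀ v₁ =
      ∏ i, ∏ j, ((u₀ + u₁ * z i) * w j + (v₀ + v₁ * z i)) := by
  rw [bilinearNorm, cubicNorm_elemSymm]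
  refine Finset.prod_congr rfl fun i _ => ?_
  simp only [elemSymm, Fin.prod_univ_three, Matrix.cons_val]
  ring

theorem quadNorm_mul_quadNorm (e : Fin 3 → S) (a b c l m n : S) :
    quadNorm e a b c * quadNorm e l m n =
      quadNorm e (a * l + (b * n + c * m) * e 2 + c * n * (e 0 * e 2))
        (a * m + b * l - (b * n + c * m) * e 1 + c * n * (e 2 - e 0 * e 1))
        (a * n + b * m + c * l + (b * n + c * m) * e 0 + c * n * (e 0 ^ 2 - e 1)) := by
  unfold quadNorm
  ring

theorem pow_three_mul_quadNorm (e : Fin 3 → S) (r a b c : S) :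
    r ^ 3 * quadNorm e a b c = quadNorm e (r * a) (r * b) (r * c) := by
  unfold quadNorm
  ring

theorem quadNorm_shift (e : Fin 3 → S) (x a b c : S) :
    quadNorm (shift e x) (a + b * x + c * x ^ 2) (b + 2 * c * x) c = quadNorm e a b c := by
  simp only [shift, quadNorm, Matrix.cons_val]
  ring

theorem cubicNorm_shift (e : Fin 3 → S) (x c₀ c₁ c₂ c₃ : S) :
    cubicNorm (shift e x) (c₀ + c₁ * x + c₂ * x ^ 2 + c₃ * x ^ 3)
      (c₁ + 2 * c₂ * x + 3 * c₃ * x ^ 2) (c₂ + 3 * c₃ * x) c₃ = cubicNorm e c₀ c₁ c₂ c₃ := by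
  rw [cubicNorm, cubicNorm, ← quadNorm_shift e x]
  simp only [shift, Matrix.cons_val]
  congr 1 <;> ring

end Norm

/-! ### The identities behind the formulas -/

section Identities

variable {S : Type*} [CommRing S]

/-- The equation at `(x, y)` of the tangent of `y² = x³ + A x + B` at `(x₁, y₁)`. -/
def tangentAt (A x₁ y₁ x y : S) : S :=
  (3 * x₁ ^ 2 + A) * x - 2 * y₁ * y + (2 * y₁ ^ 2 - (3 * x₁ ^ 2 + A) * x₁)

/-- The equation at `(x, y)` of the line through `(x₁, y₁)` and `(x₂, y₂)`. -/
def chordAt (x₁ y₁ x₂ y₂ x y : S) : S :=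
  (y₂ - y₁) * x + (x₁ - x₂) * y + ((x₂ - x₁) * y₁ + (y₁ - y₂) * x₁)

/-- The value of `T` at `(x, y)` after the `y_{P_i}` have been replaced, in terms of the elementary
symmetric functions `e` of the `x_{P_i}`. -/
def tangentNorm (D : LinePair S) (e : Fin 3 → S) (x y : S) : S :=
  cubicNorm e (D.A * x - 2 * D.α₀ * y + 2 * D.α₀ ^ 2)
    (-2 * D.α₁ * y + 4 * D.α₀ * D.α₁ - D.A) (3 * x + 2 * D.α₁ ^ 2) (-3)

/-- The value of `R` at `(x, y)` after the `y_{P_i}` and `y_{Q_i}` have been replaced, in terms of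
the elementary symmetric functions `e` of the `x_{P_i}` and `s` of the `x_{Q_i}`. -/
def chordNorm (D : LinePair S) (e s : Fin 3 → S) (x y : S) : S :=
  bilinearNorm e s (D.β₁ * x - y + D.α₀) (D.α₁ - D.β₁)
    ((D.β₀ - D.α₀) * x) (-D.α₁ * x + y - D.β₀)

theorem tangentNorm_elemSymm (D : LinePair S) (z : Fin 3 → S) (x y : S) :
    tangentNorm D (elemSymm z) x y = ∏ i, tangentAt D.A (z i) (D.α₁ * z i + D.α₀) x y := by
  rw [tangentNorm, cubicNorm_elemSymm]
  refine Finset.prod_congr rfl fun i _ => ?_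
  rw [tangentAt]
  ring

theorem chordNorm_elemSymm (D : LinePair S) (z w : Fin 3 → S) (x y : S) :
    chordNorm D (elemSymm z) (elemSymm w) x y =
      ∏ i, ∏ j, chordAt (z i) (D.α₁ * z i + D.α₀) (w j) (D.β₁ * w j + D.β₀) x y := by
  rw [chordNorm, bilinearNorm_elemSymm]
  refine Finset.prod_congr rfl fun i _ => Finset.prod_congr rfl fun j _ => ?_
  rw [chordAt]
  ring

/-- The value of `c y - (u₀ + u₁ x)`, with the coefficients of `h_{2P}`. -/
def doublingValue (D : LinePair S) (x y : S) : S := c D * y - (u₀ D + u₁ D * x)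

/-- The value at `(x, y)` of `S_{P,Q}`, with the coefficients given by the formulas. -/
def sumValue (D : LinePair S) (x y : S) : S :=
  a₄ D * x ^ 4 + a₃ D * x ^ 3 + a₂ D * x ^ 2 + a₁ D * x + a₀ D
    + y * (b₃ D * x ^ 3 + b₂ D * x ^ 2 + b₁ D * x + b₀ D)

set_option maxHeartbeats 1000000 in
theorem tangentNorm_eq (D : LinePair S) {x y : S} (h : y ^ 2 = x ^ 3 + D.A * x + D.B) :
    tangentNorm D (valueE D) x y = -((y - (D.α₁ * x + D.α₀)) ^ 2 * doublingValue D x (-y)) := by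
  obtain ⟨A, B, a, b, β₁, β₀⟩ := D
  obtain rfl : B = y ^ 2 - x ^ 3 - A * x := by rw [h]; ring
  simp only [tangentNorm, valueE, cubicNorm, quadNorm, doublingValue, c, u₀, u₁, Matrix.cons_val]
  ring

set_option maxHeartbeats 1000000 in
theorem sumValue_of_eq (D : LinePair S) {x y : S} (h : y ^ 2 = x ^ 3 + D.A * x + D.B)
    (h₁ : D.α₁ = D.β₁) (h₀ : D.α₀ = D.β₀) :
    sumValue D x y = -((y + (D.α₁ * x + D.α₀)) ^ 2 * doublingValue D x y) := by
  obtain ⟨A, B, a, b, β₁, β₀⟩ := D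
  obtain rfl : a = β₁ := h₁
  obtain rfl : b = β₀ := h₀
  obtain rfl : B = y ^ 2 - x ^ 3 - A * x := by rw [h]; ring
  simp only [sumValue, doublingValue, a₄, a₃, a₂, a₁, a₀, b₃, b₂, b₁, b₀, c, u₀, u₁]
  ring

section Translated

variable (x y d a h b k : S)

/-- The lines `Y - y = a (X - x) - h` and `Y - y = b (X - x) - k`, on the curve through `(x, y)`
with `f'(x) = d`: translating `(x, y)` to the origin makes the identity for `R` tractable. -/
def LinePair.through : LinePair S :=
  ⟨d - 3 * x ^ 2, y ^ 2 - x ^ 3 - (d - 3 * x ^ 2) * x, a, y - a * x - h, b, y - b * x - k⟩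

theorem LinePair.through_eq (D : LinePair S) {x y : S} (hxy : y ^ 2 = x ^ 3 + D.A * x + D.B) :
    through x y (D.A + 3 * x ^ 2) D.α₁ (y - (D.α₁ * x + D.α₀)) D.β₁
      (y - (D.β₁ * x + D.β₀)) = D := by
  obtain ⟨A, B, a, α₀, b, β₀⟩ := D
  rw [through, hxy]
  congr 1 <;> ring

theorem shift_valueE_through :
    shift (valueE (.through x y d a h b k)) x =
      ![a ^ 2 - 3 * x, d + 2 * a * h - 2 * y * a, h ^ 2 - 2 * y * h] := by
  ext i
  fin_cases i <;> simp only [shift, valueE, LinePair.through, Matrix.cons_val, Fin.zero_eta,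
    Fin.mk_one, Fin.reduceFinMk] <;> ring

/-- The product over the points `P_i = (x + z, y + az - h)` of `z³ h_Q(R_i)`, where
`x(R_i) = x + (d - 2y(a - h/z)) / z` is the third intersection point of the curve with the line
through `(x, y)` and `P_i`. -/
def thirdPointNorm : S :=
  cubicNorm (shift (valueE (.through x y d a h b k)) x) (-2 * y * h ^ 2)
    (2 * y * h * (a - b) - (d - 2 * y * a) * h) ((d - 2 * y * a) * (a - b)) k

set_option maxHeartbeats 4000000 in
set_option maxRecDepth 10000 in
theorem thirdPointNorm_eq :
    thirdPointNorm x y d a h b k = -(h ^ 3 * sumValue (.through x y d a h b k) x (-y)) := by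
  rw [thirdPointNorm, shift_valueE_through, cubicNorm, quadNorm, LinePair.through, sumValue,
    a₄, a₃, a₂, a₁, a₀, b₃, b₂, b₁, b₀]
  simp only [Matrix.cons_val]
  ring

theorem chordNorm_through :
    chordNorm (.through x y d a h b k) (valueE (.through x y d a h b k))
      (valueS (.through x y d a h b k)) x y =
      quadNorm (shift (valueE (.through x y d a h b k)) x) (k - h) (a - b) 0 *
        (k ^ 3 * thirdPointNorm x y d a h b k) := by
  rw [chordNorm, bilinearNorm, ← cubicNorm_shift _ x, thirdPointNorm, shift_valueE_through,
    cubicNorm, cubicNorm, pow_three_mul_quadNorm, quadNorm_mul_quadNorm]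
  simp only [valueS, LinePair.through, Matrix.cons_val]
  congr 1 <;> ring

end Translated

theorem chordNorm_eq (D : LinePair S) {x y : S} (h : y ^ 2 = x ^ 3 + D.A * x + D.B) :
    chordNorm D (valueE D) (valueS D) x y = -quadNorm (valueE D) (D.α₀ - D.β₀) (D.α₁ - D.β₁) 0 *
      ((y - (D.α₁ * x + D.α₀)) ^ 3 * (y - (D.β₁ * x + D.β₀)) ^ 3 * sumValue D x (-y)) := by
  have key := chordNorm_through x y (D.A + 3 * x ^ 2) D.α₁ (y - (D.α₁ * x + D.α₀)) D.β₁
    (y - (D.β₁ * x + D.β₀))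
  rw [thirdPointNorm_eq, D.through_eq h] at key
  have hPQ : quadNorm (shift (valueE D) x)
      (y - (D.β₁ * x + D.β₀) - (y - (D.α₁ * x + D.α₀))) (D.α₁ - D.β₁) 0 =
        quadNorm (valueE D) (D.α₀ - D.β₀) (D.α₁ - D.β₁) 0 := by
    rw [← quadNorm_shift (valueE D) x]
    congr 1 <;> ring
  rw [key, hPQ]
  ring

end Identities

/-! ### Rewriting in elementary symmetric polynomials -/

section Expand

open MvPolynomial (rename esymm sumAlgEquiv)

variable {k : Type*} [CommRing k]

theorem algebraicIndependent_esymm (k : Type*) [CommRing k] (n : ℕ) :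
    AlgebraicIndependent k fun i : Fin n => esymm (Fin n) k (i + 1) := by
  intro p q hpq
  refine MvPolynomial.esymmAlgHom_fin_injective k le_rfl (Subtype.ext ?_)
  rw [MvPolynomial.esymmAlgHom_apply, MvPolynomial.esymmAlgHom_apply, hpq]

theorem algebraicIndependent_sumElim_esymm (n : ℕ) {ι τ : Type*} {x : ι → MvPolynomial τ k}
    (hx : AlgebraicIndependent k x) :
    AlgebraicIndependent k (Sum.elim (fun i : Fin n => rename Sum.inl (esymm (Fin n) k (i + 1)))
      (rename Sum.inr ∘ x) : Fin n ⊕ ι → MvPolynomial (Fin n ⊕ τ) k) := by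
  rw [← AlgHom.algebraicIndependent_iff (sumAlgEquiv k (Fin n) τ).toAlgHom (AlgEquiv.injective _)]
  convert! hx.sumElim_comp (algebraicIndependent_esymm (MvPolynomial τ k) n) using 1
  ext1 (i | i)
  · refine (DFunLike.congr_fun (MvPolynomial.sumAlgEquiv_comp_rename_inl k (Fin n) τ) _).trans ?_
    simp [MvPolynomial.map_esymm]
  · exact DFunLike.congr_fun (MvPolynomial.sumAlgEquiv_comp_rename_inr k (Fin n) τ) (x i)

theorem expand_injective : Function.Injective (expand k) := by
  let sumOfSymVar : SymVar → Fin 3 ⊕ Fin 3 ⊕ Bool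
    | .e i => .inl i
    | .s i => .inr (.inl i)
    | .x => .inr (.inr true)
    | .y => .inr (.inr false)
  let varOfSum : Fin 3 ⊕ Fin 3 ⊕ Bool → Var
    | .inl i => .xP i
    | .inr (.inl i) => .xQ i
    | .inr (.inr true) => .x
    | .inr (.inr false) => .y
  have sumOfSymVar_injective : Function.Injective sumOfSymVar := by
    rintro (_ | _ | _ | _) (_ | _ | _ | _) <;> simp [sumOfSymVar]
  have varOfSum_injective : Function.Injective varOfSum := by
    rintro (_ | _ | _ | _) (_ | _ | _ | _) <;> simp [varOfSum]
  have indep := algebraicIndependent_sumElim_esymm 3 (algebraicIndependent_sumElim_esymm 3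
    (MvPolynomial.algebraicIndependent_X Bool k))
  have h := (indep.comp _ sumOfSymVar_injective).map'
    (MvPolynomial.rename_injective varOfSum varOfSum_injective)
  refine (?_ : expand k = MvPolynomial.aeval _) ▸ h
  ext1 v
  rw [expand, MvPolynomial.aeval_X, MvPolynomial.aeval_X]
  rcases v with i | i | _ | _ <;>
    simp only [sumOfSymVar, Function.comp_apply, Sum.elim_inl, Sum.elim_inr,
      MvPolynomial.rename_rename, MvPolynomial.rename_X] <;> rfl

theorem IsOutput.unique {D : LinePair k} {p : MvPolynomial Var k} {t t' : k[X][Y]}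
    (h : IsOutput D p t) (h' : IsOutput D p t') : t = t' := by
  obtain ⟨g, hg, rfl⟩ := h
  obtain ⟨g', hg', rfl⟩ := h'
  rw [expand_injective (hg.trans hg'.symm)]

theorem esymm_fin_three (i : Fin 3) :
    esymm (Fin 3) k (i + 1) = elemSymm MvPolynomial.X i := by
  have h₂ : Finset.powersetCard 2 (Finset.univ : Finset (Fin 3)) = {{0, 1}, {0, 2}, {1, 2}} := by
    decide
  have h₃ : Finset.powersetCard 3 (Finset.univ : Finset (Fin 3)) = {{0, 1, 2}} := by decide
  fin_cases i
  · simp [MvPolynomial.esymm_one, elemSymm, Fin.sum_univ_three]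
  · simp [esymm, h₂, elemSymm, add_assoc, show ({0, 1} : Finset (Fin 3)) ≠ {0, 2} by decide,
      show ({0, 1} : Finset (Fin 3)) ≠ {1, 2} by decide,
      show ({0, 2} : Finset (Fin 3)) ≠ {1, 2} by decide]
  · simp [esymm, h₃, elemSymm, mul_assoc]

theorem rename_esymm_fin_three {σ : Type*} (v : Fin 3 → σ) (i : Fin 3) :
    rename v (esymm (Fin 3) k (i + 1)) = elemSymm (MvPolynomial.X ∘ v) i := by
  rw [esymm_fin_three]
  refine (map_elemSymm (rename (R := k) v).toRingHom _ i).trans ?_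
  congr 1
  ext1 j
  simp

end Expand

/-! ### The output of the procedure -/

section Map

variable {k S : Type*} [CommRing k] [CommRing S] (f : k →+* S) (D : LinePair k)

/-- The image of the input of the procedure under a ring homomorphism. -/
def LinePair.map : LinePair S := ⟨f D.A, f D.B, f D.α₁, f D.α₀, f D.β₁, f D.β₀⟩

theorem LinePair.map_map {S' : Type*} [CommRing S'] (f' : S →+* S') :
    (D.map f).map f' = D.map (f'.comp f) := rfl

theorem map_tangentNorm (e : Fin 3 → k) (x y : k) :
    f (tangentNorm D e x y) = tangentNorm (D.map f) (f ∘ e) (f x) (f y) := by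
  simp [tangentNorm, LinePair.map, map_cubicNorm, map_ofNat f]

theorem map_chordNorm (e s : Fin 3 → k) (x y : k) :
    f (chordNorm D e s x y) = chordNorm (D.map f) (f ∘ e) (f ∘ s) (f x) (f y) := by
  simp [chordNorm, LinePair.map, map_bilinearNorm]

theorem valueE_map : valueE (D.map f) = f ∘ valueE D := by
  ext i
  fin_cases i <;> simp [valueE, LinePair.map, map_ofNat f]

theorem valueS_map : valueS (D.map f) = f ∘ valueS D :=
  valueE_map f ⟨D.A, D.B, D.β₁, D.β₀, D.α₁, D.α₀⟩

theorem map_doublingFormula (φ : k[X][Y] →+* S) :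
    φ (doublingFormula D) = doublingValue (D.map (φ.comp (C.comp C))) (φ (C X)) (φ Y) := by
  simp [doublingFormula, doublingValue, c, u₀, u₁, LinePair.map, map_ofNat φ, map_ofNat C]

theorem map_sumFormula (φ : k[X][Y] →+* S) :
    φ (sumFormula D) = sumValue (D.map (φ.comp (C.comp C))) (φ (C X)) (φ Y) := by
  simp only [sumFormula, sumPart₁, sumPart₂, sumValue, a₄, a₃, a₂, a₁, a₀, b₃, b₂, b₁, b₀,
    LinePair.map, RingHom.comp_apply, map_add, map_sub, map_neg, map_mul, map_pow, map_ofNat φ,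
    map_ofNat C]

end Map

section Output

variable {k : Type*} [CommRing k]

theorem expand_e (i : Fin 3) : expand k (.X (.e i)) = elemSymm (var ∘ Var.xP) i := by
  simp only [expand, MvPolynomial.aeval_X, rename_esymm_fin_three]

theorem expand_s (i : Fin 3) : expand k (.X (.s i)) = elemSymm (var ∘ Var.xQ) i := by
  simp only [expand, MvPolynomial.aeval_X, rename_esymm_fin_three]

theorem derivative_cubic (A B : k) : derivative (cubic A B) = 3 * X ^ 2 + C A := by
  simp only [cubic, derivative_add, derivative_X_pow, derivative_C_mul, derivative_X, derivative_C]
  simp [map_ofNat C]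

/-- The polynomial `T(x, y)` that the procedure computes. -/
noncomputable def tangentOutput (D : LinePair k) : k[X][Y] :=
  tangentNorm (D.map (C.comp C)) (valueE (D.map (C.comp C))) (C X) Y

/-- The polynomial `R(x, y)` that the procedure computes. -/
noncomputable def chordOutput (D : LinePair k) : k[X][Y] :=
  chordNorm (D.map (C.comp C)) (valueE (D.map (C.comp C))) (valueS (D.map (C.comp C))) (C X) Y

theorem isOutput_tangentOutput (D : LinePair k) :
    IsOutput D (tangentProduct D) (tangentOutput D) := by
  refine ⟨tangentNorm (D.map MvPolynomial.C) (.X ∘ .e) (.X .x) (.X .y), ?_, ?_⟩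
  · refine (map_tangentNorm (expand k).toRingHom _ _ _ _).trans ?_
    have he : (expand k).toRingHom ∘ (.X ∘ .e) = elemSymm (var ∘ Var.xP) := funext expand_e
    rw [he, tangentNorm_elemSymm, tangentProduct, map_prod]
    refine Finset.prod_congr rfl fun i _ => ?_
    simp [tangent, derivative_cubic, tangentAt, substY, expand, LinePair.map, map_ofNat]
  · refine Eq.trans ?_ (map_tangentNorm (substES D).toRingHom _ _ _ _).symm
    rw [tangentOutput, valueE_map]
    congr 1
    · simp [LinePair.map, substES]
    · ext1 i
      simp [substES]
    · simp [substES]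
    · simp [substES]

theorem isOutput_chordOutput (D : LinePair k) :
    IsOutput D (chordProduct k) (chordOutput D) := by
  refine ⟨chordNorm (D.map MvPolynomial.C) (.X ∘ .e) (.X ∘ .s) (.X .x) (.X .y), ?_, ?_⟩
  · refine (map_chordNorm (expand k).toRingHom _ _ _ _ _).trans ?_
    have he : (expand k).toRingHom ∘ (.X ∘ .e) = elemSymm (var ∘ Var.xP) := funext expand_e
    have hs : (expand k).toRingHom ∘ (.X ∘ .s) = elemSymm (var ∘ Var.xQ) := funext expand_s
    rw [he, hs, chordNorm_elemSymm, chordProduct, map_prod]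
    refine Finset.prod_congr rfl fun i _ => ?_
    rw [map_prod]
    refine Finset.prod_congr rfl fun j _ => ?_
    simp [chord, chordAt, expand, substY, LinePair.map]
  · refine Eq.trans ?_ (map_chordNorm (substES D).toRingHom _ _ _ _ _).symm
    rw [chordOutput, valueE_map, valueS_map]
    congr 1
    · simp [LinePair.map, substES]
    · ext1 i
      simp [substES]
    · ext1 i
      simp [substES]
    · simp [substES]
    · simp [substES]

theorem existsUnique_isOutput_tangentProduct (D : LinePair k) :
    ∃! t, IsOutput D (tangentProduct D) t :=
  ⟨_, isOutput_tangentOutput D, fun _ h => h.unique (isOutput_tangentOutput D)⟩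

theorem existsUnique_isOutput_chordProduct (D : LinePair k) :
    ∃! r, IsOutput D (chordProduct k) r :=
  ⟨_, isOutput_chordOutput D, fun _ h => h.unique (isOutput_chordOutput D)⟩

end Output

/-! ### The output modulo the equation of the curve -/

section Modulus

variable {k : Type*} [CommRing k]

theorem conjY_C (p : k[X]) : conjY (C p) = C p := C_comp

theorem conjY_conjY (g : k[X][Y]) : conjY (conjY g) = g := by
  simp [conjY, comp_assoc]

theorem conjY_line (m₁ m₀ : k) : conjY (line m₁ m₀) = -line (-m₁) (-m₀) := by
  rw [conjY, line, line, sub_comp, X_comp, C_comp]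
  simp only [C_add, C_mul, C_neg]
  ring

theorem conjY_line_sq (m₁ m₀ : k) :
    conjY (line m₁ m₀) ^ 2 = line (-m₁) (-m₀) ^ 2 := by
  rw [conjY_line]
  ring

theorem mk_Y_sq (A B : k) :
    AdjoinRoot.mk (modulus A B) Y ^ 2 = AdjoinRoot.mk (modulus A B) (C X) ^ 3
      + AdjoinRoot.mk (modulus A B) (C (C A)) * AdjoinRoot.mk (modulus A B) (C X)
      + AdjoinRoot.mk (modulus A B) (C (C B)) := by
  simp only [← map_pow, ← map_mul, ← map_add]
  rw [AdjoinRoot.mk_eq_mk]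
  simp [modulus, cubic]

theorem conjY_modulus (A B : k) : conjY (modulus A B) = modulus A B := by
  rw [conjY, modulus, sub_comp, X_pow_comp, C_comp, neg_sq]

/-- Evaluation at the point `(x, -y)`, for the generic point `(x, y)` of the curve. -/
noncomputable def evalConj (A B : k) : k[X][Y] →+* AdjoinRoot (modulus A B) :=
  (AdjoinRoot.mk (modulus A B)).comp (compRingHom (-X))

theorem evalConj_comp_C (A B : k) :
    (evalConj A B).comp (C.comp C) = (AdjoinRoot.mk (modulus A B)).comp (C.comp C) :=
  RingHom.ext fun a => congrArg (AdjoinRoot.mk (modulus A B)) (conjY_C (C a))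

theorem modulus_dvd_conjY_tangentOutput (D : LinePair k) :
    modulus D.A D.B ∣ conjY (tangentOutput D) -
      C (C (-1)) * (line (-D.α₁) (-D.α₀) ^ 2 * doublingFormula D) := by
  rw [← AdjoinRoot.mk_eq_mk]
  let φ := AdjoinRoot.mk (modulus D.A D.B)
  have key := tangentNorm_eq (D.map (φ.comp (C.comp C))) (x := φ (C X)) (y := -φ Y)
    ((neg_sq _).trans (mk_Y_sq D.A D.B))
  rw [neg_neg, ← map_doublingFormula D φ] at key
  calc φ (conjY (tangentOutput D)) = evalConj D.A D.B (tangentOutput D) := rfl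
    _ = tangentNorm (D.map (φ.comp (C.comp C))) (valueE (D.map (φ.comp (C.comp C))))
        (φ (C X)) (-φ Y) := by
      rw [tangentOutput, map_tangentNorm, ← valueE_map, LinePair.map_map, evalConj_comp_C]
      simp [evalConj, φ]
    _ = _ := by
      rw [key]
      simp only [line, LinePair.map, RingHom.comp_apply, map_mul, map_add, map_sub, map_pow,
        map_neg, map_one, φ]
      ring

theorem modulus_dvd_chordOutput (D : LinePair k) :
    modulus D.A D.B ∣ chordOutput D -
      C (C (-quadNorm (valueE D) (D.α₀ - D.β₀) (D.α₁ - D.β₁) 0)) *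
        (line D.α₁ D.α₀ ^ 3 * line D.β₁ D.β₀ ^ 3 * conjY (sumFormula D)) := by
  rw [← AdjoinRoot.mk_eq_mk]
  let φ := AdjoinRoot.mk (modulus D.A D.B)
  have key := chordNorm_eq (D.map (φ.comp (C.comp C))) (x := φ (C X)) (y := φ Y) (mk_Y_sq D.A D.B)
  have hS : φ (conjY (sumFormula D)) = sumValue (D.map (φ.comp (C.comp C))) (φ (C X)) (-φ Y) := by
    refine (map_sumFormula D (evalConj D.A D.B)).trans ?_
    rw [evalConj_comp_C]
    simp [evalConj, φ]
  calc φ (chordOutput D) = _ := by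
        rw [chordOutput, map_chordNorm, ← valueE_map, ← valueS_map, LinePair.map_map]
    _ = _ := key
    _ = _ := by
      rw [← hS, valueE_map]
      simp only [line, LinePair.map, RingHom.comp_apply, map_mul, map_add, map_sub, map_pow,
        map_neg, map_quadNorm, map_zero, Function.comp_def, φ]

theorem modulus_dvd_sumFormula_of_eq {D : LinePair k} (h₁ : D.α₁ = D.β₁) (h₀ : D.α₀ = D.β₀) :
    modulus D.A D.B ∣
      sumFormula D - C (C (-1)) * (line (-D.α₁) (-D.α₀) ^ 2 * doublingFormula D) := by
  rw [← AdjoinRoot.mk_eq_mk]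
  let φ := AdjoinRoot.mk (modulus D.A D.B)
  have key := sumValue_of_eq (D.map (φ.comp (C.comp C))) (x := φ (C X)) (y := φ Y)
    (mk_Y_sq D.A D.B) (congrArg (φ.comp (C.comp C)) h₁)
    (congrArg (φ.comp (C.comp C)) h₀)
  rw [← map_doublingFormula, ← map_sumFormula] at key
  refine key.trans ?_
  simp only [line, LinePair.map, RingHom.comp_apply, map_mul, map_add, map_sub, map_pow,
    map_neg, map_one, φ]
  ring

end Modulus

open WeierstrassCurve.Affine WeierstrassCurve.Affine.CoordinateRing

/-! ### Functions on the curve -/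

section Functions

variable {F K : Type*} [Field F] [Field K] [Algebra F K] {A B : F}

theorem monic_modulus (A B : F) : (modulus A B).Monic := monic_X_pow_sub_C _ two_ne_zero

theorem polynomial_baseChange : ((curve A B).baseChange K).polynomial =
    (modulus A B).map (mapRingHom (algebraMap F K)) := by
  simp [curve, WeierstrassCurve.baseChange, WeierstrassCurve.Affine.polynomial, modulus, cubic]

theorem negY_baseChange (x y : K) : ((curve A B).baseChange K).negY x y = -y := by
  simp [negY, curve, WeierstrassCurve.baseChange]

theorem slope_baseChange_self [DecidableEq K] (x : K) {y : K} (hy : y ≠ -y) :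
    ((curve A B).baseChange K).slope x x y y = (3 * x ^ 2 + algebraMap F K A) / (y - -y) := by
  rw [slope_of_Y_ne rfl (negY_baseChange (A := A) (B := B) x y ▸ hy), negY_baseChange]
  simp [curve, WeierstrassCurve.baseChange]

/-- The coordinate ring `K[E]` of the affine curve over `K`. -/
abbrev CoordRing (K : Type*) [Field K] [Algebra F K] (A B : F) : Type _ :=
  ((curve A B).baseChange K).CoordinateRing

variable (K A B) in
/-- The function on the curve over `K` given by a polynomial over `F`. -/
noncomputable def functionOf : F[X][Y] →+* CoordRing K A B :=
  (CoordinateRing.mk ((curve A B).baseChange K)).comp (mapRingHom (mapRingHom (algebraMap F K)))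

theorem functionOf_apply (g : F[X][Y]) : functionOf K A B g =
    CoordinateRing.mk ((curve A B).baseChange K) (g.map (mapRingHom (algebraMap F K))) := rfl

theorem functionOf_C (p : F[X]) : functionOf K A B (C p) =
    algebraMap K[X] (CoordRing K A B) (p.map (algebraMap F K)) := by
  rw [functionOf_apply, map_C]
  rfl

theorem functionOf_Y : functionOf K A B Y = CoordinateRing.mk ((curve A B).baseChange K) Y := by
  rw [functionOf_apply, map_X]

theorem functionOf_C_C (a : F) : functionOf K A B (C (C a)) =
    algebraMap K (CoordRing K A B) (algebraMap F K a) := by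
  rw [functionOf_C, map_C]
  rfl

theorem functionOf_eq_zero {g : F[X][Y]} : functionOf K A B g = 0 ↔ modulus A B ∣ g := by
  rw [← map_dvd_map (mapRingHom (algebraMap F K))
    (map_injective _ (algebraMap F K).injective) (monic_modulus A B), ← polynomial_baseChange]
  exact AdjoinRoot.mk_eq_zero

theorem functionOf_eq {g h : F[X][Y]} :
    functionOf K A B g = functionOf K A B h ↔ modulus A B ∣ g - h := by
  rw [← functionOf_eq_zero (K := K), map_sub, sub_eq_zero]

theorem conjY_map {k S : Type*} [CommRing k] [CommRing S] (f : k →+* S) (g : k[X][Y]) :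
    conjY (g.map (mapRingHom f)) = (conjY g).map (mapRingHom f) := by
  simp [conjY, Polynomial.map_comp]

theorem eval₂_neg_mk (g : K[X][Y]) :
    g.eval₂ ((CoordinateRing.mk ((curve A B).baseChange K)).comp C) (-CoordinateRing.mk _ Y) =
      CoordinateRing.mk _ (conjY g) := by
  rw [conjY, Polynomial.comp, hom_eval₂, map_neg]

/-- The automorphism `y ↦ -y` of the coordinate ring. -/
noncomputable def conjRing : CoordRing K A B →+* CoordRing K A B :=
  AdjoinRoot.lift ((CoordinateRing.mk ((curve A B).baseChange K)).comp C) (-CoordinateRing.mk _ Y)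
    (by
      have h : conjY ((curve A B).baseChange K).polynomial =
          ((curve A B).baseChange K).polynomial := by
        rw [polynomial_baseChange, conjY_map, conjY_modulus]
      rw [eval₂_neg_mk, h]
      exact AdjoinRoot.mk_self)

theorem conjRing_mk (g : K[X][Y]) : conjRing (CoordinateRing.mk ((curve A B).baseChange K) g) =
    CoordinateRing.mk ((curve A B).baseChange K) (conjY g) :=
  (AdjoinRoot.lift_mk _ _).trans (eval₂_neg_mk g)

theorem conjRing_functionOf (g : F[X][Y]) :
    conjRing (functionOf K A B g) = functionOf K A B (conjY g) := by
  rw [functionOf_apply, conjRing_mk, conjY_map, functionOf_apply]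

theorem map_conjRing_pointIdeal (P : Pt K A B) :
    (pointIdeal P).map conjRing = pointIdeal (-P) := by
  rcases P with _ | ⟨x, y, h⟩
  · exact Ideal.map_top _
  · have hX : conjRing (XClass ((curve A B).baseChange K) x) = XClass _ x := by
      rw [XClass, conjRing_mk, conjY_C]
    have hY : conjRing (YClass ((curve A B).baseChange K) (C y)) = -YClass _ (C (-y)) := by
      rw [YClass, YClass, conjRing_mk, ← map_neg, conjY, sub_comp, X_comp, C_comp, C_neg, C_neg,
        sub_neg_eq_add, neg_add]
      rfl
    rw [Point.neg_some]
    simp only [pointIdeal, XYIdeal, Ideal.map_span, Set.image_pair, hX, hY, negY_baseChange]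
    rw [Ideal.span_insert, Ideal.span_singleton_neg, ← Ideal.span_insert]

end Functions

section Constants

variable {F K : Type*} [Field F] [Field K] {W : WeierstrassCurve.Affine K}

theorem algebraMap_dvd_algebraMap {p q : K[X]} :
    algebraMap K[X] W.CoordinateRing p ∣ algebraMap K[X] W.CoordinateRing q ↔ p ∣ q := by
  refine ⟨fun ⟨z, hz⟩ => ?_, map_dvd _⟩
  obtain ⟨r, s, rfl⟩ := exists_smul_basis_eq z
  have h : (q - p * r) • (1 : W.CoordinateRing) + (-(p * s)) • CoordinateRing.mk W Y = 0 := by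
    simp only [Algebra.smul_def, map_sub, map_mul, map_neg, mul_one] at hz ⊢
    rw [hz]
    ring
  exact ⟨r, sub_eq_zero.mp (smul_basis_eq_zero h).1⟩

theorem span_algebraMap_eq_span_algebraMap {p q : K[X]} :
    Ideal.span {algebraMap K[X] W.CoordinateRing p} = Ideal.span {algebraMap _ _ q} ↔
      Associated p q := by
  rw [Ideal.span_singleton_eq_span_singleton, ← dvd_dvd_iff_associated, ← dvd_dvd_iff_associated,
    algebraMap_dvd_algebraMap, algebraMap_dvd_algebraMap]

theorem exists_algebraMap_eq_of_isUnit {u : W.CoordinateRing} (hu : IsUnit u) :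
    ∃ κ : K, algebraMap K W.CoordinateRing κ = u := by
  obtain ⟨p, q, rfl⟩ := exists_smul_basis_eq u
  have hdeg := degree_eq_zero_of_isUnit (hu.map (Algebra.norm K[X]))
  rw [degree_norm_smul_basis] at hdeg
  have hq : q = 0 := by
    by_contra hq
    have h := hdeg ▸ le_max_right (2 • p.degree) (2 • q.degree + 3)
    rw [degree_eq_natDegree hq] at h
    norm_cast at h
  have hp : p.degree ≤ 0 := by
    by_contra! hp
    exact (nsmul_pos hp two_ne_zero).not_ge (hdeg ▸ le_max_left (2 • p.degree) _)
  refine ⟨p.coeff 0, ?_⟩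
  rw [hq, zero_smul, add_zero, Algebra.smul_def, mul_one, eq_C_of_degree_le_zero hp, coeff_C_zero]
  rfl

theorem exists_eq_C_mul_of_map_eq (f : F →+* K) {r r₀ : F[X][Y]} {κ : K} (hκ : κ ≠ 0)
    (h : r.map (mapRingHom f) = C (C κ) * r₀.map (mapRingHom f)) :
    ∃ l : F, l ≠ 0 ∧ r = C (C l) * r₀ := by
  have hinj := map_injective (mapRingHom f) (map_injective f f.injective)
  rcases eq_or_ne r₀ 0 with rfl | hr₀
  · rw [Polynomial.map_zero, mul_zero] at h
    exact ⟨1, one_ne_zero, by rw [mul_zero, hinj (h.trans (Polynomial.map_zero _).symm)]⟩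
  have hlead := leadingCoeff_ne_zero.mpr (leadingCoeff_ne_zero.mpr hr₀)
  let m := r₀.natDegree
  let n := r₀.leadingCoeff.natDegree
  have hcoeff : f ((r.coeff m).coeff n) = κ * f r₀.leadingCoeff.leadingCoeff := by
    have hmn := congrArg (fun p : K[X][Y] => (p.coeff m).coeff n) h
    simp only [coeff_map, coe_mapRingHom, coeff_C_mul] at hmn
    exact hmn
  have hl : f ((r.coeff m).coeff n / r₀.leadingCoeff.leadingCoeff) = κ := by
    rw [map_div₀, hcoeff, mul_div_cancel_right₀ _ ((map_ne_zero f).mpr hlead)]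
  refine ⟨_, (map_ne_zero f).mp (hl.trans_ne hκ), hinj ?_⟩
  rw [h, Polynomial.map_mul, map_C, coe_mapRingHom, map_C, hl]

theorem exists_modulus_dvd_of_functionOf_eq [Algebra F K] {A B : F} {g g₀ : F[X][Y]} {κ : K}
    (hκ : κ ≠ 0)
    (h : functionOf K A B g = algebraMap K (CoordRing K A B) κ * functionOf K A B g₀) :
    ∃ l : F, l ≠ 0 ∧ modulus A B ∣ g - C (C l) * g₀ := by
  have hM := monic_modulus A B
  have hmod : (g %ₘ modulus A B).map (mapRingHom (algebraMap F K)) =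
      C (C κ) * (g₀ %ₘ modulus A B).map (mapRingHom (algebraMap F K)) := by
    rw [map_modByMonic _ hM, map_modByMonic _ hM, ← smul_eq_C_mul, ← smul_modByMonic,
      smul_eq_C_mul, ← sub_eq_zero, ← sub_modByMonic, modByMonic_eq_zero_iff_dvd (hM.map _),
      ← polynomial_baseChange]
    exact AdjoinRoot.mk_eq_mk.mp h
  obtain ⟨l, hl, hlmod⟩ := exists_eq_C_mul_of_map_eq _ hκ hmod
  refine ⟨l, hl, ?_⟩
  rw [← modByMonic_eq_zero_iff_dvd hM, sub_modByMonic, ← smul_eq_C_mul, smul_modByMonic, hlmod,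
    smul_eq_C_mul, sub_self]

end Constants

/-! ### Ideals of lines -/

section Lines

variable {F K : Type*} [Field F] [Field K] [Algebra F K] {A B : F}

theorem pointIdeal_zero : pointIdeal (0 : Pt K A B) = 1 := Ideal.one_eq_top.symm

theorem pointIdeal_mul_neg_some {x y : K} (h : ((curve A B).baseChange K).Nonsingular x y) :
    pointIdeal (.some x y h : Pt K A B) * pointIdeal (-.some x y h : Pt K A B) = XIdeal _ x := by
  rw [mul_comm, Point.neg_some]
  exact XYIdeal_neg_mul h

theorem span_algebraMap_mul {W : WeierstrassCurve.Affine K} {κ : K} (hκ : κ ≠ 0)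
    (g : W.CoordinateRing) :
    Ideal.span {algebraMap K W.CoordinateRing κ * g} = Ideal.span {g} :=
  Ideal.span_singleton_mul_left_unit ((isUnit_iff_ne_zero.mpr hκ).map _) g

theorem xClass_eq (x : K) : XClass ((curve A B).baseChange K) x =
    functionOf K A B (C X) - algebraMap K (CoordRing K A B) x := by
  rw [functionOf_C, map_X, XClass, C_sub, map_sub]
  rfl

theorem yClass_linePolynomial (x y l : K) :
    YClass ((curve A B).baseChange K) (linePolynomial x y l) =
      functionOf K A B Y - (algebraMap K (CoordRing K A B) l * (functionOf K A B (C X) -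
        algebraMap K _ x) + algebraMap K _ y) := by
  rw [← xClass_eq, YClass, XClass, functionOf_Y, linePolynomial, C_add, C_mul, map_sub, map_add,
    map_mul]
  rfl

variable [DecidableEq K]

theorem yIdeal_linePolynomial {x₁ y₁ x₂ y₂ : K}
    (h₁ : ((curve A B).baseChange K).Nonsingular x₁ y₁)
    (h₂ : ((curve A B).baseChange K).Nonsingular x₂ y₂)
    (hxy : ¬(x₁ = x₂ ∧ y₁ = ((curve A B).baseChange K).negY x₂ y₂)) :
    YIdeal ((curve A B).baseChange K)
        (linePolynomial x₁ y₁ (((curve A B).baseChange K).slope x₁ x₂ y₁ y₂)) =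
      pointIdeal (.some x₁ y₁ h₁ : Pt K A B) * pointIdeal (.some x₂ y₂ h₂ : Pt K A B) *
        pointIdeal (-(.some x₁ y₁ h₁ + .some x₂ y₂ h₂) : Pt K A B) := by
  have hmul := congrArg (· * pointIdeal (-(.some x₁ y₁ h₁ + .some x₂ y₂ h₂) : Pt K A B))
    (XYIdeal_mul_XYIdeal h₁.left h₂.left hxy)
  have hneg := pointIdeal_mul_neg_some (nonsingular_add h₁ h₂ hxy)
  rw [Point.add_some hxy] at hmul ⊢
  rw [← Ideal.span_singleton_mul_right_inj (XClass_ne_zero _)]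
  refine Eq.trans ?_ (hmul.symm.trans (mul_assoc ..))
  rw [mul_assoc]
  exact (mul_comm _ _).trans (congrArg _ hneg.symm)

theorem span_chordAt {x₁ y₁ x₂ y₂ : K} (h₁ : ((curve A B).baseChange K).Nonsingular x₁ y₁)
    (h₂ : ((curve A B).baseChange K).Nonsingular x₂ y₂)
    (hne : (.some x₁ y₁ h₁ : Pt K A B) ≠ .some x₂ y₂ h₂) :
    Ideal.span {chordAt (algebraMap K (CoordRing K A B) x₁) (algebraMap _ _ y₁)
        (algebraMap _ _ x₂) (algebraMap _ _ y₂) (functionOf K A B (C X)) (functionOf K A B Y)} =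
      pointIdeal (.some x₁ y₁ h₁ : Pt K A B) * pointIdeal (.some x₂ y₂ h₂ : Pt K A B) *
        pointIdeal (-(.some x₁ y₁ h₁ + .some x₂ y₂ h₂) : Pt K A B) := by
  rcases eq_or_ne x₁ x₂ with rfl | hx
  · have hy : y₁ ≠ y₂ := fun hy => hne (by subst hy; rfl)
    have hsum := Point.add_of_Y_eq (h₁ := h₁) (h₂ := h₂) rfl
      ((Y_eq_of_X_eq h₁.left h₂.left rfl).resolve_left hy)
    have hvertical : chordAt (algebraMap K (CoordRing K A B) x₁) (algebraMap _ _ y₁)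
        (algebraMap _ _ x₁) (algebraMap _ _ y₂) (functionOf K A B (C X)) (functionOf K A B Y) =
          algebraMap K _ (y₂ - y₁) * XClass _ x₁ := by
      rw [chordAt, xClass_eq, map_sub]
      ring
    rw [hsum, neg_zero, pointIdeal_zero, mul_one, hvertical,
      span_algebraMap_mul (sub_ne_zero.mpr hy.symm), ← neg_eq_of_add_eq_zero_right hsum,
      pointIdeal_mul_neg_some, XIdeal]
  · have hslope : algebraMap K (CoordRing K A B) (y₁ - y₂) =
        algebraMap K _ (x₁ - x₂) * algebraMap K _ ((y₁ - y₂) / (x₁ - x₂)) := by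
      rw [← map_mul, mul_div_cancel₀ _ (sub_ne_zero.mpr hx)]
    have hline : chordAt (algebraMap K (CoordRing K A B) x₁) (algebraMap _ _ y₁)
        (algebraMap _ _ x₂) (algebraMap _ _ y₂) (functionOf K A B (C X)) (functionOf K A B Y) =
          algebraMap K _ (x₁ - x₂) *
            YClass _ (linePolynomial x₁ y₁ ((y₁ - y₂) / (x₁ - x₂))) := by
      rw [chordAt, yClass_linePolynomial]
      simp only [map_sub] at hslope ⊢
      linear_combination (algebraMap K (CoordRing K A B) x₁ - functionOf K A B (C X)) * hslope
    rw [hline, span_algebraMap_mul (sub_ne_zero.mpr hx), ← slope_of_X_ne hx,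
      ← yIdeal_linePolynomial h₁ h₂ fun h => hx h.1, YIdeal]

theorem span_tangentAt (h2 : (2 : K) ≠ 0) {x y : K}
    (h : ((curve A B).baseChange K).Nonsingular x y) :
    Ideal.span {tangentAt (algebraMap K (CoordRing K A B) (algebraMap F K A)) (algebraMap K _ x)
        (algebraMap K _ y) (functionOf K A B (C X)) (functionOf K A B Y)} =
      pointIdeal (.some x y h : Pt K A B) ^ 2 * pointIdeal (-(2 • .some x y h) : Pt K A B) := by
  rw [two_nsmul, sq]
  rcases eq_or_ne y 0 with rfl | hy
  · have hderiv : 3 * x ^ 2 + algebraMap F K A ≠ 0 := by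
      have h' := ((nonsingular_iff' _ _).mp h).2
      simp only [curve, WeierstrassCurve.baseChange, WeierstrassCurve.map_a₁, map_zero, mul_zero,
        WeierstrassCurve.map_a₂, zero_mul, add_zero, WeierstrassCurve.map_a₄, zero_sub,
        neg_add_rev, ne_eq, WeierstrassCurve.map_a₃, not_true_eq_false, or_false] at h'
      contrapose! h'
      linear_combination -h'
    have hsum := Point.add_of_Y_eq (h₁ := h) (h₂ := h) rfl (by rw [negY_baseChange, neg_zero])
    have hvertical : tangentAt (algebraMap K (CoordRing K A B) (algebraMap F K A))
        (algebraMap K _ x) (algebraMap K _ 0) (functionOf K A B (C X)) (functionOf K A B Y) =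
          algebraMap K _ (3 * x ^ 2 + algebraMap F K A) * XClass _ x := by
      rw [tangentAt, xClass_eq, map_zero, map_add, map_mul, map_pow, map_ofNat]
      ring
    rw [hsum, neg_zero, pointIdeal_zero, mul_one, hvertical, span_algebraMap_mul hderiv, ← XIdeal,
      ← pointIdeal_mul_neg_some h, neg_eq_of_add_eq_zero_right hsum]
  · have h2y : y - -y ≠ 0 := by
      rw [sub_neg_eq_add, ← two_mul]
      exact mul_ne_zero h2 hy
    have hslope : algebraMap K (CoordRing K A B) (3 * x ^ 2 + algebraMap F K A) =
        algebraMap K _ (y - -y) *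
          algebraMap K _ (((curve A B).baseChange K).slope x x y y) := by
      rw [slope_baseChange_self x (sub_ne_zero.mp h2y), ← map_mul, mul_div_cancel₀ _ h2y]
    have hline : tangentAt (algebraMap K (CoordRing K A B) (algebraMap F K A))
        (algebraMap K _ x) (algebraMap K _ y) (functionOf K A B (C X)) (functionOf K A B Y) =
          algebraMap K _ (-(y - -y)) *
            YClass _ (linePolynomial x y (((curve A B).baseChange K).slope x x y y)) := by
      rw [tangentAt, yClass_linePolynomial]
      simp only [map_sub, map_neg, map_add, map_mul, map_pow, map_ofNat] at hslope ⊢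
      linear_combination (functionOf K A B (C X) - algebraMap K (CoordRing K A B) x) * hslope
    rw [hline, span_algebraMap_mul (neg_ne_zero.mpr h2y), ← YIdeal,
      yIdeal_linePolynomial h h fun h' => h2y (sub_eq_zero.mpr (h'.2.trans (negY_baseChange _ _)))]

end Lines

open scoped nonZeroDivisors

/-! ### Divisors -/

section Divisors

variable {F K : Type*} [Field F] [Field K] [Algebra F K] {A B : F}
variable {ι κ : Type*} [Fintype ι] [Fintype κ] {g g₀ h : F[X][Y]} {E : ι → Pt K A B}
  {E' : κ → Pt K A B}

theorem hasDivisor_iff :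
    HasDivisor g E ↔ Ideal.span {functionOf K A B g} = ∏ i, pointIdeal (E i) := Iff.rfl

theorem pointIdeal_ne_bot (P : Pt K A B) : pointIdeal P ≠ ⊥ := by
  rcases P with _ | ⟨x, y, h⟩
  · exact top_ne_bot
  · exact Submodule.ne_bot_iff _ |>.mpr
      ⟨_, Ideal.subset_span (Set.mem_insert _ _), XClass_ne_zero x⟩

theorem HasDivisor.functionOf_ne_zero (hg : HasDivisor g E) : functionOf K A B g ≠ 0 := by
  rw [ne_eq, ← Ideal.span_singleton_eq_bot, hasDivisor_iff.mp hg, ← Ideal.zero_eq_bot,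
    Finset.prod_eq_zero_iff]
  rintro ⟨i, -, hi⟩
  exact pointIdeal_ne_bot _ hi

theorem hasDivisor_congr {l : F} (hl : l ≠ 0) (h : modulus A B ∣ g - C (C l) * g₀) :
    HasDivisor g E ↔ HasDivisor g₀ E := by
  rw [hasDivisor_iff, hasDivisor_iff, functionOf_eq.mpr h, map_mul, functionOf_C_C,
    span_algebraMap_mul ((_root_.map_ne_zero _).mpr hl)]

theorem HasDivisor.exists_modulus_dvd (hg : HasDivisor g E) (hg₀ : HasDivisor g₀ E) :
    ∃ l : F, l ≠ 0 ∧ modulus A B ∣ g - C (C l) * g₀ := by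
  obtain ⟨u, hu⟩ := Ideal.span_singleton_eq_span_singleton.mp (Eq.trans hg₀ (Eq.symm hg))
  obtain ⟨l, hl⟩ := exists_algebraMap_eq_of_isUnit u.isUnit
  have hl₀ : l ≠ 0 := by
    rintro rfl
    exact u.ne_zero (hl.symm.trans (map_zero _))
  refine exists_modulus_dvd_of_functionOf_eq hl₀ ?_
  rw [hl, mul_comm]
  exact hu.symm

theorem HasDivisor.iff_exists_modulus_dvd (hg₀ : HasDivisor g₀ E) :
    HasDivisor g E ↔ ∃ l : F, l ≠ 0 ∧ modulus A B ∣ g - C (C l) * g₀ :=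
  ⟨fun hg => hg.exists_modulus_dvd hg₀, fun ⟨_, hl, h⟩ => (hasDivisor_congr hl h).mpr hg₀⟩

theorem HasDivisor.eqUpToConst_iff {D : LinePair F} {E : ι → Pt K D.A D.B} {p q : F[X][Y]}
    (hp : HasDivisor p E) : EqUpToConst D p q ↔ HasDivisor q E :=
  ⟨fun ⟨_, hκ, h⟩ => (hasDivisor_congr hκ h).mp hp, fun hq => hp.exists_modulus_dvd hq⟩

theorem HasDivisor.mul (hg : HasDivisor g E) (hh : HasDivisor h E') :
    HasDivisor (g * h) (Sum.elim E E') := by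
  rw [hasDivisor_iff] at *
  rw [map_mul, ← Ideal.span_singleton_mul_span_singleton, hg, hh, Fintype.prod_sum_type]
  rfl

theorem HasDivisor.of_mul (hg : HasDivisor g E) (hgh : HasDivisor (g * h) (Sum.elim E E')) :
    HasDivisor h E' := by
  rw [hasDivisor_iff, ← Ideal.span_singleton_mul_right_inj hg.functionOf_ne_zero,
    Ideal.span_singleton_mul_span_singleton, ← map_mul, hasDivisor_iff.mp hg]
  exact (hasDivisor_iff.mp hgh).trans (Fintype.prod_sum_type _)

theorem HasDivisor.mul_iff (hg : HasDivisor g E) :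
    HasDivisor (g * h) (Sum.elim E E') ↔ HasDivisor h E' :=
  ⟨hg.of_mul, hg.mul⟩

theorem HasDivisor.pow_card_fst (κ : Type*) [Fintype κ] (hg : HasDivisor g E) :
    HasDivisor (g ^ Fintype.card κ) fun ij : ι × κ => E ij.1 := by
  rw [hasDivisor_iff, map_pow, ← Ideal.span_singleton_pow, hasDivisor_iff.mp hg,
    Fintype.prod_prod_type, ← Finset.prod_pow]
  simp only [Finset.prod_const, Finset.card_univ]

theorem HasDivisor.pow_card_snd (κ : Type*) [Fintype κ] (hg : HasDivisor g E) :
    HasDivisor (g ^ Fintype.card κ) fun ij : κ × ι => E ij.2 := by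
  rw [hasDivisor_iff, map_pow, ← Ideal.span_singleton_pow, hasDivisor_iff.mp hg,
    Fintype.prod_prod_type]
  exact (Finset.prod_const _).symm

theorem HasDivisor.pow_card_mul_pow_card (hg : HasDivisor g E) (hh : HasDivisor h E') :
    HasDivisor (g ^ Fintype.card κ * h ^ Fintype.card ι)
      (Sum.elim (fun ij : ι × κ => E ij.1) fun ij : ι × κ => E' ij.2) :=
  (hg.pow_card_fst κ).mul (hh.pow_card_snd ι)

theorem HasDivisor.conjY (hg : HasDivisor g E) : HasDivisor (conjY g) fun i => -E i := by
  rw [hasDivisor_iff, ← conjRing_functionOf, ← Set.image_singleton, ← Ideal.map_span,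
    hasDivisor_iff.mp hg]
  exact (map_prod (Ideal.mapHom conjRing) _ _).trans
    (Finset.prod_congr rfl fun i _ => map_conjRing_pointIdeal (E i))

theorem hasDivisor_conjY :
    HasDivisor (TraceZero.conjY g) (fun i => -E i) ↔ HasDivisor g E :=
  ⟨fun hg => by simpa only [conjY_conjY, neg_neg] using hg.conjY, HasDivisor.conjY⟩

theorem HasDivisor.comp_perm (σ : Equiv.Perm ι) : HasDivisor g (E ∘ σ) ↔ HasDivisor g E := by
  rw [hasDivisor_iff, hasDivisor_iff, ← Equiv.prod_comp σ fun i => pointIdeal (E i)]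
  rfl

theorem exists_units_coe_eq_pointIdeal [DecidableEq K] (P : Pt K A B) :
    ∃ I : (FractionalIdeal (CoordRing K A B)⁰ (FractionRing (CoordRing K A B)))ˣ,
      (I : FractionalIdeal (CoordRing K A B)⁰ (FractionRing (CoordRing K A B))) =
        (pointIdeal P : Ideal (CoordRing K A B)) ∧
      ClassGroup.mk (FractionRing (CoordRing K A B)) I = (Point.toClass P).toMul := by
  rcases P with _ | ⟨x, y, h⟩
  · exact ⟨1, (FractionalIdeal.coeIdeal_top ..).symm, map_one _⟩
  · exact ⟨XYIdeal' h, XYIdeal'_eq h, rfl⟩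

theorem HasDivisor.sum_eq_zero [DecidableEq K] (hg : HasDivisor g E) : ∑ i, E i = 0 := by
  choose I hI hclass using exists_units_coe_eq_pointIdeal (K := K) (A := A) (B := B)
  have hprod : (∏ i, I (E i) :
        FractionalIdeal (CoordRing K A B)⁰ (FractionRing (CoordRing K A B))) =
      (∏ i, pointIdeal (E i) : Ideal (CoordRing K A B)) := by
    refine Eq.trans ?_ (map_prod (FractionalIdeal.coeIdealHom _ _) _ _).symm
    exact Finset.prod_congr rfl fun i _ => hI (E i)
  have hone := (ClassGroup.mk_eq_one_of_coe_ideal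
    ((Units.coe_prod _ _).trans hprod)).mpr ⟨_, hg.functionOf_ne_zero, hg.symm⟩
  apply Point.toClass_injective
  rw [map_sum, map_zero]
  apply Additive.toMul.injective
  rw [toMul_sum, toMul_zero, ← hone, map_prod]
  exact Finset.prod_congr rfl fun i _ => (hclass (E i)).symm

end Divisors

/-! ### Collinear triples -/

section Collinear

variable {F K : Type*} [Field F] [Field K] [Algebra F K] {A B : F}

/-- The polynomial `X - x(P)`, whose divisor is `P + (-P) - 2 P_∞`, read as `1` for `P = P_∞`. -/
noncomputable def xPoly : Pt K A B → K[X]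
  | .zero => 1
  | .some x _ _ => X - C x

theorem pointIdeal_mul_neg (P : Pt K A B) : pointIdeal P * pointIdeal (-P) =
    Ideal.span {algebraMap K[X] (CoordRing K A B) (xPoly P)} := by
  rcases P with _ | ⟨x, y, h⟩
  · rw [xPoly, map_one, Ideal.span_singleton_one]
    exact Ideal.top_mul _
  · exact pointIdeal_mul_neg_some h

theorem natDegree_xPoly_le_one (P : Pt K A B) : (xPoly P).natDegree ≤ 1 := by
  rcases P with _ | ⟨x, _, _⟩
  · exact natDegree_one.trans_le zero_le_one
  · exact (natDegree_X_sub_C x).le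

theorem natDegree_xPoly_eq_one {P : Pt K A B} : (xPoly P).natDegree = 1 ↔ P ≠ 0 := by
  rcases P with _ | ⟨x, _, h⟩
  · exact iff_of_false (natDegree_one.trans_ne zero_ne_one) (not_not_intro rfl)
  · exact iff_of_true (natDegree_X_sub_C x) (Point.some_ne_zero h)

theorem monic_xPoly (P : Pt K A B) : (xPoly P).Monic := by
  rcases P with _ | ⟨x, _, _⟩
  · exact monic_one
  · exact monic_X_sub_C x

variable {ι : Type*} [Fintype ι]

theorem natDegree_prod_xPoly_eq_card {E : ι → Pt K A B} :
    (∏ i, xPoly (E i)).natDegree = Fintype.card ι ↔ ∀ i, E i ≠ 0 := by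
  rw [natDegree_prod_of_monic _ _ fun i _ => monic_xPoly (E i), Fintype.card_eq_sum_ones,
    Finset.sum_eq_sum_iff_of_le fun i _ => natDegree_xPoly_le_one (E i)]
  simp only [Finset.mem_univ, forall_const, natDegree_xPoly_eq_one]

theorem HasDivisor.associated_prod_xPoly {g : F[X][Y]} {E : ι → Pt K A B} {p : F[X]}
    (hg : HasDivisor g E) (hp : modulus A B ∣ g * TraceZero.conjY g - C p) :
    Associated (p.map (algebraMap F K)) (∏ i, xPoly (E i)) := by
  rw [← span_algebraMap_eq_span_algebraMap (W := (curve A B).baseChange K), ← functionOf_C,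
    ← functionOf_eq.mpr hp, map_mul, ← Ideal.span_singleton_mul_span_singleton,
    hasDivisor_iff.mp hg, hasDivisor_iff.mp hg.conjY, ← Finset.prod_mul_distrib,
    Finset.prod_congr rfl fun i _ => pointIdeal_mul_neg (E i), Ideal.prod_span_singleton, map_prod]

theorem HasDivisor.prod_xPoly_of_line {m₁ m₀ : F} {P : ι → Pt K A B}
    (hP : HasDivisor (line m₁ m₀) P) : ∏ i, xPoly (P i) = Cubic.toPoly ⟨1, -algebraMap F K m₁ ^ 2,
      algebraMap F K (A - 2 * m₀ * m₁), -algebraMap F K (m₀ ^ 2 - B)⟩ := by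
  have hnorm : modulus A B ∣ line m₁ m₀ * TraceZero.conjY (line m₁ m₀) -
      C (-(cubic A B - (C m₁ * X + C m₀) ^ 2)) := by
    refine ⟨-1, ?_⟩
    rw [conjY_line]
    simp only [line, modulus, C_neg, C_sub, C_add, C_mul, C_pow]
    ring
  have hcubic : (cubic A B - (C m₁ * X + C m₀) ^ 2).map (algebraMap F K) =
      Cubic.toPoly ⟨1, -algebraMap F K m₁ ^ 2, algebraMap F K (A - 2 * m₀ * m₁),
        -algebraMap F K (m₀ ^ 2 - B)⟩ := by
    simp only [cubic, Cubic.toPoly, Polynomial.map_sub, Polynomial.map_add, Polynomial.map_mul,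
      Polynomial.map_pow, map_X, map_C, C_neg, C_1, map_sub, map_mul, map_pow, map_ofNat]
    ring
  have hassoc := hP.associated_prod_xPoly hnorm
  rw [Polynomial.map_neg, Associated.neg_left_iff, hcubic] at hassoc
  exact (eq_of_monic_of_associated Cubic.monic_of_a_eq_one'
    (monic_prod_of_monic _ _ fun i _ => monic_xPoly (P i)) hassoc).symm

theorem HasDivisor.ne_zero_of_line {m₁ m₀ : F} {P : Fin 3 → Pt K A B}
    (hP : HasDivisor (line m₁ m₀) P) (i : Fin 3) : P i ≠ 0 := by
  refine natDegree_prod_xPoly_eq_card.mp ?_ i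
  rw [hP.prod_xPoly_of_line, Cubic.natDegree_of_a_ne_zero' one_ne_zero, Fintype.card_fin]

end Collinear

section CollinearCoordinates

theorem evalEval_eq_zero_of_mem_XYIdeal {K : Type*} [Field K] {W : WeierstrassCurve.Affine K}
    {x y : K} (h : W.Equation x y) {g : K[X][Y]}
    (hg : CoordinateRing.mk W g ∈ XYIdeal W x (C y)) : g.evalEval x y = 0 := by
  let ev : W.CoordinateRing →+* K := AdjoinRoot.lift (evalRingHom x) y
    (by rw [eval₂_evalRingHom]; exact h)
  have hev (p : K[X][Y]) : ev (CoordinateRing.mk W p) = p.evalEval x y := by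
    rw [← eval₂_evalRingHom]
    exact AdjoinRoot.lift_mk _ _
  have hker : XYIdeal W x (C y) ≤ RingHom.ker ev := by
    rw [XYIdeal, Ideal.span_le, Set.pair_subset_iff]
    simp only [SetLike.mem_coe, RingHom.mem_ker, XClass, YClass, hev, evalEval_sub, evalEval_C,
      eval_sub, eval_X, eval_C, evalEval_X, sub_self, and_self]
  exact (hev g).symm.trans (hker hg)

variable {F K : Type*} [Field F] [Field K] [Algebra F K] {A B m₁ m₀ : F}

theorem equation_baseChange {x y : K} : ((curve A B).baseChange K).Equation x y ↔
    y ^ 2 = x ^ 3 + algebraMap F K A * x + algebraMap F K B := by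
  rw [equation_iff]
  simp [curve, WeierstrassCurve.baseChange]

theorem HasDivisor.evalEval_eq_zero {ι : Type*} [Fintype ι] {g : F[X][Y]} {E : ι → Pt K A B}
    (hg : HasDivisor g E) {i : ι} {x y : K} {h : ((curve A B).baseChange K).Nonsingular x y}
    (hi : E i = .some x y h) : (g.map (mapRingHom (algebraMap F K))).evalEval x y = 0 := by
  refine evalEval_eq_zero_of_mem_XYIdeal h.left ?_
  have hle : ∏ i, pointIdeal (E i) ≤ pointIdeal (E i) :=
    Ideal.le_of_dvd (Finset.dvd_prod_of_mem _ (Finset.mem_univ i))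
  rw [hi, ← hasDivisor_iff.mp hg] at hle
  exact hle (Ideal.mem_span_singleton_self _)

variable {P Q : Fin 3 → Pt K A B}

theorem HasDivisor.exists_coords (hP : HasDivisor (line m₁ m₀) P) :
    ∃ (x : Fin 3 → K) (hx : ∀ i, ((curve A B).baseChange K).Nonsingular (x i)
      (algebraMap F K m₁ * x i + algebraMap F K m₀)),
      P = (fun i => .some _ _ (hx i)) ∧
      elemSymm x = algebraMap F K ∘ ![m₁ ^ 2, A - 2 * m₀ * m₁, m₀ ^ 2 - B] := by
  have hsome (i : Fin 3) : ∃ (x : K) (h : ((curve A B).baseChange K).Nonsingular x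
      (algebraMap F K m₁ * x + algebraMap F K m₀)), P i = .some _ _ h := by
    rcases hPi : P i with _ | ⟨x, y, h⟩
    · exact absurd hPi (hP.ne_zero_of_line i)
    · have hline := hP.evalEval_eq_zero hPi
      simp only [line, Polynomial.map_sub, map_X, map_C, evalEval_sub, evalEval_X, evalEval_C,
        coe_mapRingHom, Polynomial.map_add, Polynomial.map_mul, eval_add, eval_mul, eval_C, eval_X,
        sub_eq_zero] at hline
      subst hline
      exact ⟨x, h, rfl⟩
  choose x hx hPx using hsome
  refine ⟨x, hx, funext hPx, ?_⟩
  have hprod := hP.prod_xPoly_of_line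
  simp only [hPx, Fin.prod_univ_three, xPoly, Cubic.prod_X_sub_C_eq, Cubic.toPoly_injective,
    Cubic.mk.injEq, neg_inj, true_and] at hprod
  obtain ⟨h₁, h₂, h₃⟩ := hprod
  funext i
  fin_cases i
  · simpa [elemSymm] using h₁
  · simpa [elemSymm] using h₂
  · simpa [elemSymm] using h₃

theorem HasDivisor.exists_eq_some (hP : HasDivisor (line m₁ m₀) P) {u : K}
    (hu : ((curve A B).baseChange K).Nonsingular u
      (algebraMap F K m₁ * u + algebraMap F K m₀)) : ∃ i, P i = .some _ _ hu := by
  obtain ⟨x, hx, rfl, he⟩ := hP.exists_coords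
  have hprod : ∏ i, (u + -1 * x i + 0 * x i ^ 2) = 0 := by
    rw [← quadNorm_elemSymm, he, quadNorm]
    have hcurve := equation_baseChange.mp hu.left
    simp only [Function.comp_apply, Matrix.cons_val, map_sub, map_mul, map_pow, map_ofNat]
    linear_combination -hcurve
  obtain ⟨i, -, hi⟩ := Finset.prod_eq_zero_iff.mp hprod
  obtain rfl : u = x i := by linear_combination hi
  exact ⟨i, rfl⟩

theorem HasDivisor.prod_comp_eq {M : Type*} [CommMonoid M] (hP : HasDivisor (line m₁ m₀) P)
    (hQ : HasDivisor (line m₁ m₀) Q) (f : Pt K A B → M) : ∏ i, f (P i) = ∏ i, f (Q i) := by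
  classical
  have hxQ := hP.prod_xPoly_of_line.trans hQ.prod_xPoly_of_line.symm
  obtain ⟨x, hx, rfl, -⟩ := hP.exists_coords
  obtain ⟨x', hx', rfl, -⟩ := hQ.exists_coords
  have hroots : Finset.univ.val.map x = Finset.univ.val.map x' := by
    rw [← roots_multiset_prod_X_sub_C (Finset.univ.val.map x),
      ← roots_multiset_prod_X_sub_C (Finset.univ.val.map x'), Multiset.map_map, Multiset.map_map]
    exact congrArg roots hxQ
  let value (t : K) : M :=
    if h : ((curve A B).baseChange K).Nonsingular t
      (algebraMap F K m₁ * t + algebraMap F K m₀) then f (.some _ _ h) else 1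
  have hvalue {z : Fin 3 → K} (hz : ∀ i, ((curve A B).baseChange K).Nonsingular (z i)
      (algebraMap F K m₁ * z i + algebraMap F K m₀)) :
      ∏ i, f (.some _ _ (hz i)) = ((Finset.univ.val.map z).map value).prod := by
    rw [Multiset.map_map]
    exact Finset.prod_congr rfl fun i _ => by
      simp only [value, Function.comp_apply, dif_pos (hz i)]
  rw [hvalue, hvalue, hroots]

end CollinearCoordinates

/-! ### The divisors of the formulas -/

section Formulas

variable {F K : Type*} [Field F] [Field K] [Algebra F K] {D : LinePair F}

theorem functionOf_comp_C_C (A B : F) : (functionOf K A B).comp (C.comp C) =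
    (algebraMap K (CoordRing K A B)).comp (algebraMap F K) :=
  RingHom.ext fun a => by simp only [RingHom.comp_apply, functionOf_C_C]

theorem functionOf_comp_elemSymm (A B : F) {x : Fin 3 → K} {e : Fin 3 → F}
    (hx : elemSymm x = algebraMap F K ∘ e) : (functionOf K A B).comp (C.comp C) ∘ e =
      elemSymm (algebraMap K (CoordRing K A B) ∘ x) := by
  rw [functionOf_comp_C_C, RingHom.coe_comp, Function.comp_assoc, ← hx]
  exact funext fun i => map_elemSymm _ x i

theorem functionOf_tangentOutput {x : Fin 3 → K} (hx : elemSymm x = algebraMap F K ∘ valueE D) :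
    functionOf K D.A D.B (tangentOutput D) =
      ∏ i, tangentAt (algebraMap K _ (algebraMap F K D.A)) (algebraMap K _ (x i))
        (algebraMap K _ (algebraMap F K D.α₁ * x i + algebraMap F K D.α₀))
        (functionOf K D.A D.B (C X)) (functionOf K D.A D.B Y) := by
  rw [tangentOutput, map_tangentNorm, ← valueE_map, LinePair.map_map, valueE_map,
    functionOf_comp_elemSymm D.A D.B hx, tangentNorm_elemSymm, functionOf_comp_C_C]
  simp only [map_add, map_mul]
  rfl

theorem functionOf_chordOutput {x x' : Fin 3 → K} (hx : elemSymm x = algebraMap F K ∘ valueE D)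
    (hx' : elemSymm x' = algebraMap F K ∘ valueS D) :
    functionOf K D.A D.B (chordOutput D) =
      ∏ i, ∏ j, chordAt (algebraMap K _ (x i))
        (algebraMap K _ (algebraMap F K D.α₁ * x i + algebraMap F K D.α₀))
        (algebraMap K _ (x' j))
        (algebraMap K _ (algebraMap F K D.β₁ * x' j + algebraMap F K D.β₀))
        (functionOf K D.A D.B (C X)) (functionOf K D.A D.B Y) := by
  rw [chordOutput, map_chordNorm, ← valueE_map, ← valueS_map, LinePair.map_map, valueE_map,
    valueS_map, functionOf_comp_elemSymm D.A D.B hx, functionOf_comp_elemSymm D.A D.B hx',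
    chordNorm_elemSymm, functionOf_comp_C_C]
  simp only [map_add, map_mul]
  rfl

variable {P Q : Fin 3 → Pt K D.A D.B}

theorem quadNorm_ne_zero (hP : HasDivisor (line D.α₁ D.α₀) P)
    (hQ : HasDivisor (line D.β₁ D.β₀) Q) (hPQ : ∀ i j, P i ≠ Q j) :
    quadNorm (valueE D) (D.α₀ - D.β₀) (D.α₁ - D.β₁) 0 ≠ 0 := by
  obtain ⟨x, hx, rfl, he⟩ := hP.exists_coords
  intro hnorm
  have hprod := congrArg (algebraMap F K) hnorm
  have he : elemSymm x = algebraMap F K ∘ valueE D := he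
  rw [map_quadNorm, ← he, quadNorm_elemSymm, map_zero, Finset.prod_eq_zero_iff] at hprod
  obtain ⟨i, -, hi⟩ := hprod
  have hy : algebraMap F K D.α₁ * x i + algebraMap F K D.α₀ =
      algebraMap F K D.β₁ * x i + algebraMap F K D.β₀ := by
    rw [map_sub, map_sub] at hi
    linear_combination hi
  obtain ⟨j, hj⟩ := hQ.exists_eq_some (hy ▸ hx i)
  refine hPQ i j (Eq.trans ?_ hj.symm)
  simp only [hy]

theorem HasDivisor.conjY_line_sq (hP : HasDivisor (line D.α₁ D.α₀) P) :
    HasDivisor (line (-D.α₁) (-D.α₀) ^ 2) (Sum.elim (fun i => -P i) fun i => -P i) := by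
  rw [← TraceZero.conjY_line_sq, sq]
  exact hP.conjY.mul hP.conjY

variable [DecidableEq K]

theorem HasDivisor.tangentOutput (h2 : (2 : K) ≠ 0) (hP : HasDivisor (line D.α₁ D.α₀) P) :
    HasDivisor (tangentOutput D) (Sum.elim (Sum.elim P P) fun i => -(2 • P i)) := by
  obtain ⟨x, hx, rfl, he⟩ := hP.exists_coords
  rw [hasDivisor_iff, functionOf_tangentOutput he, ← Ideal.prod_span_singleton,
    Finset.prod_congr rfl fun i _ => span_tangentAt h2 (hx i), Finset.prod_mul_distrib,
    Finset.prod_pow, sq, Fintype.prod_sum_type, Fintype.prod_sum_type]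
  rfl

theorem HasDivisor.chordOutput (hP : HasDivisor (line D.α₁ D.α₀) P)
    (hQ : HasDivisor (line D.β₁ D.β₀) Q) (hPQ : ∀ i j, P i ≠ Q j) :
    HasDivisor (chordOutput D)
      (Sum.elim (Sum.elim (fun ij : Fin 3 × Fin 3 => P ij.1) fun ij : Fin 3 × Fin 3 => Q ij.2)
        fun ij : Fin 3 × Fin 3 => -(P ij.1 + Q ij.2)) := by
  obtain ⟨x, hx, rfl, he⟩ := hP.exists_coords
  obtain ⟨x', hx', rfl, he'⟩ := hQ.exists_coords
  rw [hasDivisor_iff, functionOf_chordOutput he he', ← Fintype.prod_prod_type',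
    ← Ideal.prod_span_singleton,
    Finset.prod_congr rfl fun ij _ => span_chordAt (hx ij.1) (hx' ij.2) (hPQ ij.1 ij.2),
    Finset.prod_mul_distrib, Finset.prod_mul_distrib, Fintype.prod_sum_type,
    Fintype.prod_sum_type]
  rfl

theorem HasDivisor.conjY_tangentOutput (h2 : (2 : K) ≠ 0) (hP : HasDivisor (line D.α₁ D.α₀) P) :
    HasDivisor (TraceZero.conjY (TraceZero.tangentOutput D))
      (Sum.elim (Sum.elim (fun i => -P i) fun i => -P i) fun i => 2 • P i) := by
  convert (hP.tangentOutput h2).conjY using 1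
  funext ij
  rcases ij with (i | i) | i
  · rfl
  · rfl
  · exact (neg_neg _).symm

theorem HasDivisor.doublingFormula (h2 : (2 : K) ≠ 0) (hP : HasDivisor (line D.α₁ D.α₀) P) :
    HasDivisor (doublingFormula D) fun i => 2 • P i :=
  hP.conjY_line_sq.mul_iff.mp <| (hasDivisor_congr (neg_ne_zero.mpr one_ne_zero)
    (modulus_dvd_conjY_tangentOutput D)).mp (hP.conjY_tangentOutput h2)

theorem HasDivisor.sumFormula_of_ne (hP : HasDivisor (line D.α₁ D.α₀) P)
    (hQ : HasDivisor (line D.β₁ D.β₀) Q) (hPQ : ∀ i j, P i ≠ Q j) :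
    HasDivisor (sumFormula D) fun ij : Fin 3 × Fin 3 => P ij.1 + Q ij.2 := by
  have hR := hP.chordOutput hQ hPQ
  rw [hasDivisor_congr (neg_ne_zero.mpr (quadNorm_ne_zero hP hQ hPQ))
    (modulus_dvd_chordOutput D)] at hR
  exact hasDivisor_conjY.mp ((hP.pow_card_mul_pow_card hQ).mul_iff.mp hR)

theorem HasDivisor.sumFormula_of_eq (h2 : (2 : K) ≠ 0) (hP : HasDivisor (line D.α₁ D.α₀) P)
    (hQ : HasDivisor (line D.β₁ D.β₀) Q) (h₁ : D.α₁ = D.β₁) (h₀ : D.α₀ = D.β₀) :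
    HasDivisor (sumFormula D) fun ij : Fin 3 × Fin 3 => P ij.1 + Q ij.2 := by
  rw [← h₁, ← h₀] at hQ
  rw [hasDivisor_congr (neg_ne_zero.mpr one_ne_zero) (modulus_dvd_sumFormula_of_eq h₁ h₀),
    hasDivisor_iff]
  refine (hP.conjY_line_sq.mul (hP.doublingFormula h2)).trans ?_
  have hsum : P 0 + P 1 + P 2 = 0 := (Fin.sum_univ_three P).symm.trans hP.sum_eq_zero
  have h01 : P 0 + P 1 = -P 2 := eq_neg_of_add_eq_zero_left hsum
  have h02 : P 0 + P 2 = -P 1 := eq_neg_of_add_eq_zero_left (by rw [← hsum]; abel)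
  have h12 : P 1 + P 2 = -P 0 := eq_neg_of_add_eq_zero_left (by rw [← hsum]; abel)
  rw [Fintype.prod_prod_type,
    Finset.prod_congr rfl fun i _ => hQ.prod_comp_eq hP fun R => pointIdeal (P i + R)]
  simp only [Fintype.prod_sum_type, Sum.elim_inl, Sum.elim_inr, Fin.prod_univ_three, two_nsmul,
    add_comm (P 1) (P 0), add_comm (P 2) (P 0), add_comm (P 2) (P 1), h01, h02, h12]
  ring

theorem HasDivisor.sumFormula (h2 : (2 : K) ≠ 0) (hP : HasDivisor (line D.α₁ D.α₀) P)
    (hQ : HasDivisor (line D.β₁ D.β₀) Q)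
    (hPQ : ∀ i j, P i = Q j → D.α₁ = D.β₁ ∧ D.α₀ = D.β₀) :
    HasDivisor (sumFormula D) fun ij : Fin 3 × Fin 3 => P ij.1 + Q ij.2 := by
  by_cases hlines : D.α₁ = D.β₁ ∧ D.α₀ = D.β₀
  · exact hP.sumFormula_of_eq h2 hQ hlines.1 hlines.2
  · exact hP.sumFormula_of_ne hQ fun i j hij => hlines (hPQ i j hij)

end Formulas

section NormalForm

variable {F : Type*} [Field F] {A B : F}

theorem modulus_dvd_C_add_Y_mul_C {p q : F[X]} :
    modulus A B ∣ C p + Y * C q ↔ p = 0 ∧ q = 0 := by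
  constructor
  · intro h
    rw [add_comm, mul_comm] at h
    have hdeg : (C q * Y + C p).degree < (modulus A B).degree := by
      rw [modulus, degree_X_pow_sub_C two_pos]
      exact degree_linear_lt
    have hzero := eq_zero_of_dvd_of_degree_lt h hdeg
    exact ⟨by simpa using congrArg (coeff · 0) hzero, by simpa using congrArg (coeff · 1) hzero⟩
  · rintro ⟨rfl, rfl⟩
    rw [C_0, mul_zero, add_zero]
    exact dvd_zero _

theorem modulus_dvd_sumFormula_iff {D : LinePair F} {s₁ s₂ : F[X]} {κ : F} :
    modulus A B ∣ C s₁ + Y * C s₂ - C (C κ) * sumFormula D ↔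
      s₁ = C κ * sumPart₁ D ∧ s₂ = C κ * sumPart₂ D := by
  rw [← sub_eq_zero (a := s₁), ← sub_eq_zero (a := s₂),
    ← modulus_dvd_C_add_Y_mul_C (A := A) (B := B), sumFormula]
  simp only [C_sub, C_mul]
  ring_nf

theorem modulus_dvd_linear_iff {d v₀ v₁ d' v₀' v₁' κ : F} :
    modulus A B ∣ C (C d) * Y - C (C v₀ + C v₁ * X) -
        C (C κ) * (C (C d') * Y - C (C v₀' + C v₁' * X)) ↔
      d = κ * d' ∧ v₀ = κ * v₀' ∧ v₁ = κ * v₁' := by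
  have hnormal : C (C d) * Y - C (C v₀ + C v₁ * X) -
        C (C κ) * (C (C d') * Y - C (C v₀' + C v₁' * X)) =
      C (C (κ * v₀' - v₀) + C (κ * v₁' - v₁) * X) + Y * C (C (d - κ * d')) := by
    simp only [C_sub, C_mul, C_add]
    ring
  have hlinear {a b : F} : C a + C b * X = 0 ↔ a = 0 ∧ b = 0 := by
    refine ⟨fun h => ⟨?_, ?_⟩, fun ⟨ha, hb⟩ => by simp [ha, hb]⟩
    · simpa using congrArg (coeff · 0) h
    · simpa using congrArg (coeff · 1) h
  rw [hnormal, modulus_dvd_C_add_Y_mul_C, hlinear, C_eq_zero, sub_eq_zero, sub_eq_zero,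
    sub_eq_zero, and_comm, eq_comm (a := κ * v₀'), eq_comm (a := κ * v₁')]

theorem line_eq_linear (m₁ m₀ : F) : line m₁ m₀ = C (C 1) * Y - C (C m₀ + C m₁ * X) := by
  rw [line, C_1, C_1, one_mul, add_comm]

variable {K ι : Type*} [Field K] [Algebra F K] [Fintype ι] {E : ι → Pt K A B}

theorem HasDivisor.line_unique {m₁ m₀ n₁ n₀ : F} (hm : HasDivisor (line m₁ m₀) E)
    (hn : HasDivisor (line n₁ n₀) E) : m₁ = n₁ ∧ m₀ = n₀ := by
  obtain ⟨κ, -, hκ⟩ := hm.exists_modulus_dvd hn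
  rw [line_eq_linear, line_eq_linear, modulus_dvd_linear_iff, mul_one] at hκ
  obtain ⟨rfl, h₀, h₁⟩ := hκ
  exact ⟨h₁.trans (one_mul _), h₀.trans (one_mul _)⟩

end NormalForm

/-! ### Correctness of the procedure -/

section Correctness

theorem quadNorm_symbolic_ne_zero {F : Type*} [CommRing F] [Nontrivial F] (A B : F) :
    quadNorm (valueE (symbolic A B)) ((symbolic A B).α₀ - (symbolic A B).β₀)
      ((symbolic A B).α₁ - (symbolic A B).β₁) 0 ≠ 0 := by
  intro h
  have hval := congrArg (MvPolynomial.eval ![0, 1, 0, 0]) h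
  rw [map_quadNorm] at hval
  simp [symbolic, quadNorm] at hval

variable {k : Type*} [CommRing k] {D : LinePair k} {t : k[X][Y]}

theorem IsOutput.eqUpToConst_doublingFormula [Nontrivial k] (ht : IsOutput D (tangentProduct D) t) :
    EqUpToConst D (conjY t) (line (-D.α₁) (-D.α₀) ^ 2 * doublingFormula D) := by
  rw [ht.unique (isOutput_tangentOutput D)]
  exact ⟨-1, neg_ne_zero.mpr one_ne_zero, modulus_dvd_conjY_tangentOutput D⟩

theorem IsOutput.eqUpToConst_sumFormula
    (hD : quadNorm (valueE D) (D.α₀ - D.β₀) (D.α₁ - D.β₁) 0 ≠ 0)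
    (ht : IsOutput D (chordProduct k) t) :
    EqUpToConst D t (line D.α₁ D.α₀ ^ 3 * line D.β₁ D.β₀ ^ 3 * conjY (sumFormula D)) := by
  rw [ht.unique (isOutput_chordOutput D)]
  exact ⟨_, neg_ne_zero.mpr hD, modulus_dvd_chordOutput D⟩

variable {F K : Type*} [Field F] [Field K] [DecidableEq K] [Algebra F K] {D : LinePair F}
  {P Q : Fin 3 → Pt K D.A D.B} {t : F[X][Y]}

theorem IsOutput.eqUpToConst_iff_hasDivisor_two_nsmul (h2 : (2 : K) ≠ 0)
    (hP : HasDivisor (line D.α₁ D.α₀) P) (ht : IsOutput D (tangentProduct D) t) {g : F[X][Y]} :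
    EqUpToConst D (conjY t) (line (-D.α₁) (-D.α₀) ^ 2 * g) ↔ HasDivisor g fun i => 2 • P i := by
  rw [ht.unique (isOutput_tangentOutput D), (hP.conjY_tangentOutput h2).eqUpToConst_iff,
    hP.conjY_line_sq.mul_iff]

theorem IsOutput.eqUpToConst_iff_hasDivisor_add (hP : HasDivisor (line D.α₁ D.α₀) P)
    (hQ : HasDivisor (line D.β₁ D.β₀) Q) (hPQ : ∀ i j, P i ≠ Q j)
    (ht : IsOutput D (chordProduct F) t) {g : F[X][Y]} :
    EqUpToConst D t (line D.α₁ D.α₀ ^ 3 * line D.β₁ D.β₀ ^ 3 * conjY g) ↔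
      HasDivisor g fun ij : Fin 3 × Fin 3 => P ij.1 + Q ij.2 := by
  rw [ht.unique (isOutput_chordOutput D), (hP.chordOutput hQ hPQ).eqUpToConst_iff]
  exact (hP.pow_card_mul_pow_card hQ).mul_iff.trans hasDivisor_conjY

theorem hasDivisor_add_iff (h2 : (2 : K) ≠ 0) (hP : HasDivisor (line D.α₁ D.α₀) P)
    (hQ : HasDivisor (line D.β₁ D.β₀) Q)
    (hPQ : ∀ i j, P i = Q j → D.α₁ = D.β₁ ∧ D.α₀ = D.β₀) {s₁ s₂ : F[X]} :
    HasDivisor (C s₁ + Y * C s₂) (fun ij : Fin 3 × Fin 3 => P ij.1 + Q ij.2) ↔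
      ∃ κ : F, κ ≠ 0 ∧ s₁ = C κ * sumPart₁ D ∧ s₂ = C κ * sumPart₂ D := by
  simp only [(hP.sumFormula h2 hQ hPQ).iff_exists_modulus_dvd, modulus_dvd_sumFormula_iff]

theorem hasDivisor_two_nsmul_iff (h2 : (2 : K) ≠ 0) (hP : HasDivisor (line D.α₁ D.α₀) P)
    {d v₀ v₁ : F} :
    HasDivisor (C (C d) * Y - C (C v₀ + C v₁ * X)) (fun i => 2 • P i) ↔
      ∃ κ : F, κ ≠ 0 ∧ d = κ * c D ∧ v₀ = κ * u₀ D ∧ v₁ = κ * u₁ D := by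
  simp only [(hP.doublingFormula h2).iff_exists_modulus_dvd, doublingFormula,
    modulus_dvd_linear_iff]

/-- Were `c` zero, the norm of `h_{2P}` would be the square of `u₀ + u₁ x`, hence of even degree,
yet its roots are the `x`-coordinates of three points. -/
theorem c_ne_zero (h2 : (2 : K) ≠ 0) (hP : HasDivisor (line D.α₁ D.α₀) P)
    (h2P : ∀ i, 2 • P i ≠ 0) : c D ≠ 0 := by
  intro hc
  have hnorm : doublingFormula D * conjY (doublingFormula D) -
      C ((C (u₀ D) + C (u₁ D) * X) ^ 2) = 0 := by
    rw [doublingFormula, hc, C_0, C_0, zero_mul, zero_sub, ← C_neg, conjY_C, ← C_mul, neg_mul_neg,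
      ← sq, sub_self]
  have hassoc := (hP.doublingFormula h2).associated_prod_xPoly (hnorm ▸ dvd_zero _)
  have hdeg := natDegree_eq_of_degree_eq (degree_eq_degree_of_associated hassoc)
  rw [natDegree_prod_xPoly_eq_card.mpr h2P, Polynomial.map_pow, natDegree_pow,
    Fintype.card_fin] at hdeg
  omega

theorem hasDivisor_line_two_nsmul_iff (h2 : (2 : K) ≠ 0) (hP : HasDivisor (line D.α₁ D.α₀) P)
    (h2P : ∀ i, 2 • P i ≠ 0) {γ₁ γ₀ : F} :
    HasDivisor (line γ₁ γ₀) (fun i => 2 • P i) ↔ γ₁ = u₁ D / c D ∧ γ₀ = u₀ D / c D := by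
  have hc := c_ne_zero h2 hP h2P
  rw [line_eq_linear, hasDivisor_two_nsmul_iff h2 hP, eq_div_iff hc, eq_div_iff hc]
  constructor
  · rintro ⟨κ, -, hκ, rfl, rfl⟩
    exact ⟨by linear_combination -u₁ D * hκ, by linear_combination -u₀ D * hκ⟩
  · rintro ⟨h₁, h₀⟩
    refine ⟨(c D)⁻¹, inv_ne_zero hc, (inv_mul_cancel₀ hc).symm, ?_, ?_⟩
    · rw [← h₀, mul_comm, mul_inv_cancel_right₀ hc]
    · rw [← h₁, mul_comm, mul_inv_cancel_right₀ hc]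

end Correctness

/-! ### Frobenius orbits -/

section Orbits

variable {F K : Type*} [Field F] [Fintype F] [Field K] [DecidableEq K] [Algebra F K] {A B : F}

theorem frob_iterate_some {x y : K} (h : ((curve A B).baseChange K).Nonsingular x y) (n : ℕ) :
    ∃ h', frob^[n] (Point.some x y h : Pt K A B) =
      .some ((FiniteField.frobeniusAlgHom F K)^[n] x) ((FiniteField.frobeniusAlgHom F K)^[n] y)
        h' := by
  induction n with
  | zero => exact ⟨h, rfl⟩
  | succ n ih =>
    obtain ⟨h', hiter⟩ := ih
    simp only [Function.iterate_succ_apply', hiter]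
    exact ⟨((curve A B).baseChange_nonsingular
      (FiniteField.frobeniusAlgHom F K).injective ..).mpr h', rfl⟩

theorem frob_iterate_finrank [FiniteDimensional F K] (P : Pt K A B) :
    frob^[Module.finrank F K] P = P := by
  have : Finite K := Module.finite_of_finite F
  rcases P with _ | ⟨x, y, h⟩
  · exact iterate_map_zero frob _
  · obtain ⟨h', hiter⟩ := frob_iterate_some h (Module.finrank F K)
    have hfix (z : K) : (FiniteField.frobeniusAlgHom F K)^[Module.finrank F K] z = z := by
      rw [← AlgHom.coe_pow, ← FiniteField.orderOf_frobeniusAlgHom F K, pow_orderOf_eq_one]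
      rfl
    rw [hiter]
    exact (Point.some.injEq ..).mpr ⟨hfix x, hfix y⟩

theorem orbit_ne_zero {P : Pt K A B} (hP : P ≠ 0) (i : Fin 3) : orbit P i ≠ 0 := by
  rcases P with _ | ⟨x, y, h⟩
  · exact absurd rfl hP
  · obtain ⟨h', hiter⟩ := frob_iterate_some h i
    rw [orbit, hiter]
    exact Point.some_ne_zero h'

theorem orbit_two_nsmul (P : Pt K A B) (i : Fin 3) : orbit (2 • P) i = 2 • orbit P i :=
  iterate_map_nsmul (frob : Pt K A B →+ Pt K A B) i P 2

theorem orbit_add (hK : Module.finrank F K = 3) (P : Pt K A B) (i j : Fin 3) :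
    orbit P (i + j) = frob^[i] (orbit P j) := by
  have : FiniteDimensional F K := Module.finite_of_finrank_eq_succ hK
  have hperiod : Function.IsPeriodicPt frob 3 P := by
    rw [← hK]
    exact frob_iterate_finrank P
  rw [orbit, orbit, Fin.val_add, hperiod.iterate_mod_apply, Function.iterate_add_apply]

theorem orbit_eq_comp (hK : Module.finrank F K = 3) {P Q : Pt K A B} {i j : Fin 3}
    (h : orbit P i = orbit Q j) : orbit P = orbit Q ∘ Equiv.addRight (j - i) := by
  funext l
  calc orbit P l = frob^[(l - i : Fin 3)] (orbit P i) := by rw [← orbit_add hK, sub_add_cancel]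
    _ = orbit Q (l - i + j) := by rw [h, orbit_add hK]
    _ = orbit Q (l + (j - i)) := by rw [add_sub, sub_add_eq_add_sub]

theorem IsLineOf.eq_of_orbit_eq (hK : Module.finrank F K = 3) {P Q : Pt K A B} {m₁ m₀ n₁ n₀ : F}
    (hP : IsLineOf P m₁ m₀) (hQ : IsLineOf Q n₁ n₀) (i j : Fin 3) (h : orbit P i = orbit Q j) :
    m₁ = n₁ ∧ m₀ = n₀ := by
  rw [IsLineOf, orbit_eq_comp hK h, HasDivisor.comp_perm] at hP
  exact hP.line_unique hQ

end Orbits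

end TraceZero

theorem mainTheorem6_general {F K : Type*} [Field F] [Field K] [DecidableEq K] [Algebra F K]
    (h2 : ringChar F ≠ 2) (A B : F) :
    ((∃! t, IsOutput (symbolic A B) (tangentProduct (symbolic A B)) t) ∧
      (∃! r, IsOutput (symbolic A B) (chordProduct _) r) ∧
      (∀ t, IsOutput (symbolic A B) (tangentProduct (symbolic A B)) t →
        EqUpToConst (symbolic A B) (conjY t)
          (line (-(symbolic A B).α₁) (-(symbolic A B).α₀) ^ 2 *
            doublingFormula (symbolic A B))) ∧
      (∀ r, IsOutput (symbolic A B) (chordProduct _) r →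
        EqUpToConst (symbolic A B) r
          (line (symbolic A B).α₁ (symbolic A B).α₀ ^ 3 *
            line (symbolic A B).β₁ (symbolic A B).β₀ ^ 3 *
            conjY (sumFormula (symbolic A B))))) ∧
    ∀ P Q : Fin 3 → Pt K A B, ∀ D : LinePair F, D.A = A → D.B = B →
      HasDivisor (line D.α₁ D.α₀) P → HasDivisor (line D.β₁ D.β₀) Q →
      (∀ i j, P i = Q j → D.α₁ = D.β₁ ∧ D.α₀ = D.β₀) →
      ((∃! t, IsOutput D (tangentProduct D) t) ∧
        ∀ t, IsOutput D (tangentProduct D) t → ∀ g : F[X][Y],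
          (EqUpToConst D (conjY t) (line (-D.α₁) (-D.α₀) ^ 2 * g) ↔
            HasDivisor g fun i => 2 • P i)) ∧
      ((∃! r, IsOutput D (chordProduct F) r) ∧
        ∀ r, IsOutput D (chordProduct F) r → ¬ (D.α₁ = D.β₁ ∧ D.α₀ = D.β₀) →
          ∀ g : F[X][Y],
          (EqUpToConst D r (line D.α₁ D.α₀ ^ 3 * line D.β₁ D.β₀ ^ 3 * conjY g) ↔
            HasDivisor g fun ij : Fin 3 × Fin 3 => P ij.1 + Q ij.2)) ∧
      (∀ s₁ s₂ : F[X],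
        HasDivisor (C s₁ + Y * C s₂) (fun ij : Fin 3 × Fin 3 => P ij.1 + Q ij.2) ↔
          ∃ κ : F, κ ≠ 0 ∧ s₁ = C κ * sumPart₁ D ∧ s₂ = C κ * sumPart₂ D) ∧
      (∀ d v₀ v₁ : F,
        HasDivisor (C (C d) * Y - C (C v₀ + C v₁ * X)) (fun i => 2 • P i) ↔
          ∃ κ : F, κ ≠ 0 ∧ d = κ * c D ∧ v₀ = κ * u₀ D ∧ v₁ = κ * u₁ D) ∧
      ((∀ i, 2 • P i ≠ 0) → c D ≠ 0 ∧ ∀ γ₁ γ₀ : F,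
        HasDivisor (line γ₁ γ₀) (fun i => 2 • P i) ↔ γ₁ = u₁ D / c D ∧ γ₀ = u₀ D / c D) := by
  have h2K : (2 : K) ≠ 0 := by
    rw [← map_ofNat (algebraMap F K)]
    exact (_root_.map_ne_zero _).mpr (Ring.two_ne_zero h2)
  refine ⟨⟨existsUnique_isOutput_tangentProduct _, existsUnique_isOutput_chordProduct _,
    fun t ht => ht.eqUpToConst_doublingFormula,
    fun r hr => hr.eqUpToConst_sumFormula (quadNorm_symbolic_ne_zero A B)⟩, ?_⟩
  rintro P Q D rfl rfl hP hQ hPQ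
  exact ⟨⟨existsUnique_isOutput_tangentProduct D,
      fun t ht g => ht.eqUpToConst_iff_hasDivisor_two_nsmul h2K hP⟩,
    ⟨existsUnique_isOutput_chordProduct D,
      fun r hr hne g => hr.eqUpToConst_iff_hasDivisor_add hP hQ fun i j hij => hne (hPQ i j hij)⟩,
    fun s₁ s₂ => hasDivisor_add_iff h2K hP hQ hPQ,
    fun d v₀ v₁ => hasDivisor_two_nsmul_iff h2K hP,
    fun h2P => ⟨c_ne_zero h2K hP h2P, fun γ₁ γ₀ => hasDivisor_line_two_nsmul_iff h2K hP h2P⟩⟩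

theorem mainTheorem6
    {F K : Type*} [Field F] [Fintype F] [Field K] [DecidableEq K] [Algebra F K]
    (hK : Module.finrank F K = 3) (h2 : ringChar F ≠ 2) (h3 : ringChar F ≠ 3)
    (A B : F) (hE : (cubic A B).Separable) :
    -- The procedure, run with indeterminate line coefficients, yields the formulas.
    ((∃! t, IsOutput (symbolic A B) (tangentProduct (symbolic A B)) t) ∧
      (∃! r, IsOutput (symbolic A B) (chordProduct _) r) ∧
      (∀ t, IsOutput (symbolic A B) (tangentProduct (symbolic A B)) t →
        EqUpToConst (symbolic A B) (conjY t)
          (line (-(symbolic A B).α₁) (-(symbolic A B).α₀) ^ 2 *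
            doublingFormula (symbolic A B))) ∧
      (∀ r, IsOutput (symbolic A B) (chordProduct _) r →
        EqUpToConst (symbolic A B) r
          (line (symbolic A B).α₁ (symbolic A B).α₀ ^ 3 *
            line (symbolic A B).β₁ (symbolic A B).β₀ ^ 3 *
            conjY (sumFormula (symbolic A B))))) ∧
    -- For all nonzero points `P, Q` of trace zero:
    ∀ P Q : Pt K A B, TraceZeroPoint P → TraceZeroPoint Q →
      P ≠ 0 → Q ≠ 0 → ∀ D : LinePair F, D.A = A → D.B = B →
      IsLineOf P D.α₁ D.α₀ → IsLineOf Q D.β₁ D.β₀ →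
      -- the procedure, run on the coefficients of `h_P` and `h_Q`, recovers exactly `h_{2P}`
      ((∃! t, IsOutput D (tangentProduct D) t) ∧
        ∀ t, IsOutput D (tangentProduct D) t → ∀ g : F[X][Y],
          (EqUpToConst D (conjY t) (line (-D.α₁) (-D.α₀) ^ 2 * g) ↔
            HasDivisor g (orbit (2 • P)))) ∧
      -- and exactly `S_{P,Q}`, if `h_P ≠ h_Q`;
      ((∃! r, IsOutput D (chordProduct F) r) ∧
        ∀ r, IsOutput D (chordProduct F) r → ¬ (D.α₁ = D.β₁ ∧ D.α₀ = D.β₀) →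
          ∀ g : F[X][Y],
          (EqUpToConst D r (line D.α₁ D.α₀ ^ 3 * line D.β₁ D.β₀ ^ 3 * conjY g) ↔
            HasDivisor g (sums P Q))) ∧
      -- the formulas give the coefficients of `S_{P,Q}`, up to a nonzero constant, in all cases;
      (∀ s₁ s₂ : F[X], HasDivisor (C s₁ + Y * C s₂) (sums P Q) ↔
        ∃ κ : F, κ ≠ 0 ∧ s₁ = C κ * sumPart₁ D ∧ s₂ = C κ * sumPart₂ D) ∧
      -- the formulas give the coefficients of `h_{2P}`, up to a nonzero constant, in all cases,
      (∀ d v₀ v₁ : F,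
        HasDivisor (C (C d) * Y - C (C v₀ + C v₁ * X)) (orbit (2 • P)) ↔
          ∃ κ : F, κ ≠ 0 ∧ d = κ * c D ∧ v₀ = κ * u₀ D ∧ v₁ = κ * u₁ D) ∧
      -- so that `h_{2P} = y - (u₁/c x + u₀/c)` whenever `2P` is not the point at infinity.
      (2 • P ≠ 0 → c D ≠ 0 ∧ ∀ γ₁ γ₀ : F, IsLineOf (2 • P) γ₁ γ₀ ↔
        γ₁ = u₁ D / c D ∧ γ₀ = u₀ D / c D) := by
  have hgeneral := mainTheorem6_general (K := K) h2 A B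
  refine ⟨hgeneral.1, fun P Q _ _ _ _ D hA hB hlP hlQ => ?_⟩
  have h := hgeneral.2 _ _ D hA hB hlP hlQ (hlP.eq_of_orbit_eq hK hlQ)
  simp only [← orbit_two_nsmul] at h
  exact ⟨h.1, h.2.1, h.2.2.1, h.2.2.2.1, fun h2P => h.2.2.2.2 (orbit_ne_zero h2P)⟩
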